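/- Let $X=\{X_t:t\in\mathbb Z\}$ be a real, (second-order) stationary, purely nondeterministic process with mean $\mu$ and autocovariances $\gamma(h)=\mathrm{Cov}(X_0,X_h)$ satisfying $\sum_{h}|\gamma(h)|<\infty$, and let $f(\lambda)=(2\pi)^{-1}\sum_{h\in\mathbb Z}\gamma(h)e^{-ih\lambda}$ be its spectral density. (Purely nondeterministic: with $\mathcal M_n$ the closed linear span in $L^2$ of $\{X_t-\mu:t\le n\}$, one has $X_{n+1}-\mu\notin\mathcal M_n$ for all $n$, and $\bigcap_n\mathcal M_n=\{0\}$.) Put $\bar X_n=n^{-1}\sum_{t=1}^nX_t$ and assume that $f(0)>0$ and that $\sqrt n(\bar X_n-\mu)\to\mathcal N(0,2\pi f(0))$ in distribution. Let $\hat f_n$ be an estimator of $f$ computed from $X_1,\dots,X_n$ whose values are nonnegative, even, $2\pi$-periodic functions on $\mathbb R$, bounded by a constant not depending on $n$, with $\int_{-\pi}^{\pi}\log\hat f_n(\lambda)\,d\lambda>-\infty$ and $\sup_{\lambda\in[0,\pi]}|\hat f_n(\lambda)-f(\lambda)|\to0$ in probability. Put $$\hat a_{k,n}=\frac1{2\pi}\int_{-\pi}^{\pi}\log\hat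 f_n(\lambda)e^{-ik\lambda}\,d\lambda,\quad \hat\sigma_n^2=2\pi e^{\hat a_{0,n}},\quad \hat c_{0,n}=1,\quad \hat c_{k+1,n}=\sum_{j=0}^k\Bigl(1-\frac j{k+1}\Bigr)\hat a_{k+1-j,n}\hat c_{j,n}\ (k\ge0).$$ Assume that $\sum_{k\ge0}|\hat c_{k,n}|<C$ and that $\hat f_n$ is twice differentiable with a second derivative whose total variation on $[-\pi,\pi]$ is at most $V$, where $C$ and $V$ are constants not depending on $n$. Spectral density-driven bootstrap (SDDB): given $X_1,\dots,X_n$, let $\{\varepsilon_t^*:t\in\mathbb Z\}$ be i.i.d. with a law (depending on the data and on $n$) such that $E^*\varepsilon_t^*=0$, $E^*(\varepsilon_t^*)^2=\hat\sigma_n^2$ and $E^*(\varepsilon_t^*)^4<K$, where $K<\infty$ is a constant not depending on $n$; here $P^*,E^*$ denote conditional probability and expectation given the data. Put $X_t^*=\sum_{j\ge0}\hat c_{j,n}\varepsilon^*_{t-j}+\bar X_n$ for $t=1,\dots,n$, and $\bar X_n^*=n^{-1}\sum_{t=1}^nX_t^*$. Let $\delta>0$. Let $\tilde f_n(0)$ be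 an estimator of $f(0)$ computed from $X_1,\dots,X_n$ with $\tilde f_n(0)\ge\delta$ for all $n$ and $\tilde f_n(0)\to f(0)$ in probability. Let $\tilde f_n^*(0)$ be an estimator computed from the pseudo observations $X_1^*,\dots,X_n^*$ (and possibly also from $X_1,\dots,X_n$) with $\tilde f_n^*(0)\ge\delta$ for all $n$ and, for every $\varepsilon>0$, $P^*(|\tilde f_n^*(0)-f(0)|\ge\varepsilon)\to0$ in probability. (All requirements on estimators and conditional laws for fixed $n$ are meant almost surely.) Then, as $n\to\infty$, $$d_2\!\left(\frac{\sqrt n(\bar X_n^*-\bar X_n)}{(2\pi\tilde f_n^*(0))^{1/2}},\ \frac{\sqrt n(\bar X_n-\mu)}{(2\pi\tilde f_n(0))^{1/2}}\right)\to0\quad\text{in probability},$$ where the first argument is taken under its conditional law given $X_1,\dots,X_n$, and $d_2$ is Mallows distance: $d_2(U,W)=\{\int_0^1(F_U^{-1}(p)-F_W^{-1}(p))^2\,dp\}^{1/2}$ for random variables with distribution functions $F_U,F_W$. -/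

import Mathlib

open MeasureTheory ProbabilityTheory Filter Topology Set
open scoped ENNReal NNReal

noncomputable section

/-! ### Stationary processes -/

/-- Second-order (weak) stationarity with mean `m`. -/
structure IsWeaklyStationary {Ω : Type*} [MeasurableSpace Ω] (P : Measure Ω) (X : ℤ → Ω → ℝ)
    (m : ℝ) : Prop where
  memLp : ∀ t, MemLp (X t) 2 P
  mean : ∀ t, ∫ ω, X t ω ∂P = m
  cov : ∀ s t h : ℤ, covariance (X s) (X (s + h)) P = covariance (X t) (X (t + h)) P

/-- The autocovariance function `γ(h) = Cov(X_0, X_h)`. -/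
def autocov {Ω : Type*} [MeasurableSpace Ω] (P : Measure Ω) (X : ℤ → Ω → ℝ) (h : ℤ) : ℝ :=
  covariance (X 0) (X h) P

/-- The spectral density belonging to an absolutely summable autocovariance function,
`f(λ) = (2π)⁻¹ ∑_h γ(h) exp(-ihλ)`. As `γ` is real and even the series equals
`∑_h γ(h) cos(hλ)`. -/
def spectralDensity (γ : ℤ → ℝ) (l : ℝ) : ℝ :=
  (2 * Real.pi)⁻¹ * ∑' h : ℤ, γ h * Real.cos (h * l)

/-- The linear past `M_n(Y)`: the closed linear span of `Y_t`, `t ≤ n`, in `L²(P)`. -/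
def linearPast {Ω : Type*} [MeasurableSpace Ω] (P : Measure Ω) (Y : ℤ → Ω → ℝ) (n : ℤ) :
    Submodule ℝ (Lp ℝ 2 P) :=
  (Submodule.span ℝ {u : Lp ℝ 2 P | ∃ t ≤ n, u =ᵐ[P] Y t}).topologicalClosure

/-- A (centred) process is purely nondeterministic if it is nondeterministic, i.e. `Y_{n+1}`
is not in `M_n(Y)`, and its remote past `⋂ₙ M_n(Y)` is trivial. -/
def IsPurelyNondeterministic {Ω : Type*} [MeasurableSpace Ω] (P : Measure Ω)
    (Y : ℤ → Ω → ℝ) : Prop :=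
  (∀ n : ℤ, ∀ u : Lp ℝ 2 P, u =ᵐ[P] Y (n + 1) → u ∉ linearPast P Y n) ∧
    ⨅ n : ℤ, linearPast P Y n = ⊥

/-- The data `(X_1, …, X_n)`; the coordinate `i : Fin n` is `X_{i+1}`. -/
def sample {Ω : Type*} (X : ℤ → Ω → ℝ) (n : ℕ) (ω : Ω) : Fin n → ℝ :=
  fun i => X ((i : ℤ) + 1) ω

def sampleMean {n : ℕ} (x : Fin n → ℝ) : ℝ := (∑ i, x i) / n

/-! ### Estimated Wold representation -/

/-- A function that has the shape of a spectral density: nonnegative, even, `2π`-periodic. -/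
structure IsSpectralShape (g : ℝ → ℝ) : Prop where
  nonneg : ∀ l, 0 ≤ g l
  even : ∀ l, g (-l) = g l
  periodic : Function.Periodic g (2 * Real.pi)

/-- `∫_{(-π,π]} log g > -∞` for a nonnegative bounded `g`: since `Real.log 0 = 0`, it is
said that `g` vanishes almost nowhere and that `log g` is integrable. -/
def LogIntegrable (g : ℝ → ℝ) : Prop :=
  (∀ᵐ l ∂(volume.restrict (Ioc (-Real.pi) Real.pi)), 0 < g l) ∧
    IntegrableOn (fun l => Real.log (g l)) (Ioc (-Real.pi) Real.pi)

/-- The Fourier coefficient `a_k = (2π)⁻¹ ∫_{-π}^{π} log g(λ) exp(-ikλ) dλ`; the integral is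
written with the cosine because `g` is even. -/
def logFourier (g : ℝ → ℝ) (k : ℕ) : ℝ :=
  (2 * Real.pi)⁻¹ * ∫ l in (-Real.pi)..Real.pi, Real.log (g l) * Real.cos (k * l)

/-- The innovation variance `σ² = 2π exp(a_0)`. -/
def innovVar (g : ℝ → ℝ) : ℝ := 2 * Real.pi * Real.exp (logFourier g 0)

/-- The coefficients of the Wold representation: `c_0 = 1` and
`c_{k+1} = ∑_{j=0}^k (1 - j/(k+1)) a_{k+1-j} c_j`. -/
def woldCoeff (g : ℝ → ℝ) : ℕ → ℝ
  | 0 => 1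
  | k + 1 => ∑ j : Fin (k + 1),
      (1 - (j : ℝ) / ((k : ℝ) + 1)) * logFourier g (k + 1 - j) * woldCoeff g j

/-! ### The bootstrap -/

/-- The pseudo observations `X*_t = ∑_{j ≥ 0} c_j ε*_{t-j} + m`, `t = 1, …, n`. -/
def pseudoSample (c : ℕ → ℝ) (m : ℝ) (n : ℕ) (e : ℤ → ℝ) : Fin n → ℝ :=
  fun i => (∑' j : ℕ, c j * e ((i : ℤ) + 1 - j)) + m

/-- The joint law of the pseudo innovations `(ε*_t)_{t ∈ ℤ}`: i.i.d. with law `q`. -/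
def innovLaw (q : Measure ℝ) : Measure (ℤ → ℝ) := Measure.infinitePi (fun _ : ℤ => q)

/-- The studentized mean `√n (x̄ - m) / (2π v)^{1/2}` of a sample `x` of size `n`. -/
def studentized {n : ℕ} (x : Fin n → ℝ) (m v : ℝ) : ℝ :=
  √n * (sampleMean x - m) / √(2 * Real.pi * v)

/-! ### Mallows distance and convergence in probability -/

/-- The quantile function `F⁻¹(p) = inf {x | p ≤ F(x)}` of the law `ν`. -/
def quantile (ν : Measure ℝ) (p : ℝ) : ℝ := sInf {x : ℝ | p ≤ (ν (Iic x)).toReal}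

/-- Mallows distance `d₂ = {∫₀¹ (F⁻¹ - G⁻¹)²}^{1/2}` of two laws on `ℝ`. -/
def mallows (ν ν' : Measure ℝ) : ℝ≥0∞ :=
  (∫⁻ p in Ioo (0 : ℝ) 1, ENNReal.ofReal ((quantile ν p - quantile ν' p) ^ 2)) ^ (1 / 2 : ℝ)

/-- `D_n → 0` in `P`-probability for `[0, ∞]`-valued `D_n`. -/
def ToZeroInProb {Ω : Type*} [MeasurableSpace Ω] (P : Measure Ω) (D : ℕ → Ω → ℝ≥0∞) : Prop :=
  ∀ ε : ℝ≥0∞, 0 < ε → Tendsto (fun n => P {ω | ε ≤ D n ω}) atTop (𝓝 0)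

end

/-! ### Trigonometric sums and the Fejér kernel -/

/-! Both laws are compared with the standard normal law. Convergence to it in Mallows distance
follows from weak convergence together with an asymptotic upper bound `1` on the second moments
(`tendsto_mallowsSq_gaussianReal`). For the quantile functions, Fatou bounds the integral of the
squared sum from below, and the parallelogram law then forces the squared difference to vanish.
Studentizing by a consistent estimator bounded below by `δ` preserves both properties, since the
squares of the numerators are uniformly integrable (`tendsto_mallowsSq_studentize`).

For the data, weak convergence is assumed, and the second moment of the scaled mean is a Cesàro mean
of autocovariances tending to `∑ γ(h) = 2π f(0)`.

For the bootstrap, the recursion for the `c_k` says that `∑ c_k z^k = exp (∑_{k ≥ 1} a_k z^k)` in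
the unit disc. Poisson integration of the logarithm and passage to the boundary give `σ² |∑ c_k
exp(ikλ)|² = 2π g(λ)` wherever the estimate `g` is positive (`innovVar_mul_norm_transfer_sq`). The
variance of the scaled bootstrap mean is therefore the Fejér integral of `g`. It differs from that
of `f` by at most `2π` times the sup distance, and the latter integral tends to `2π f(0)`. The
scaled mean is a limit of linear combinations of i.i.d. innovations with weights at most `C/√n`. A
Lyapunov argument makes its characteristic function Gaussian up to an error of order `n^{-1/2}`,
with constants depending only on `K`, `C` and the argument.

All these bounds are uniform in the bootstrap parameters, so there are deterministic thresholds
(`exists_uniform_mallowsSq_bootstrap_le`). They apply to each data realization outside two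
exceptional events, on which the spectral estimate or the conditional law of the variance estimator
is bad; the probabilities of these events tend to zero. -/

theorem norm_sum_mul_exp_sq {ι : Type*} (S : Finset ι) (w θ : ι → ℝ) :
    ‖∑ s ∈ S, (w s : ℂ) * Complex.exp (θ s * Complex.I)‖ ^ 2 =
      ∑ s ∈ S, ∑ u ∈ S, w s * w u * Real.cos (θ s - θ u) := by
  rw [Complex.sq_norm, Complex.normSq_apply]
  simp only [Complex.re_sum, Complex.im_sum, Complex.re_ofReal_mul, Complex.im_ofReal_mul,
    Complex.exp_ofReal_mul_I_re, Complex.exp_ofReal_mul_I_im, Finset.sum_mul_sum,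
    ← Finset.sum_add_distrib]
  refine Finset.sum_congr rfl fun s _ => Finset.sum_congr rfl fun u _ => ?_
  rw [Real.cos_sub]; ring

theorem integral_cos_int_mul (k : ℤ) :
    ∫ l in (-Real.pi)..Real.pi, Real.cos (k * l) = if k = 0 then 2 * Real.pi else 0 := by
  split_ifs with h
  · subst h; simp; ring
  · have hk : (k : ℝ) ≠ 0 := by exact_mod_cast h
    rw [intervalIntegral.integral_comp_mul_left _ hk]
    simp [integral_cos, Real.sin_int_mul_pi]

theorem integral_cos_mul_cos (h k : ℤ) :
    ∫ l in (-Real.pi)..Real.pi, Real.cos (h * l) * Real.cos (k * l) =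
      Real.pi * ((if h = k then 1 else 0) + (if h = -k then 1 else 0)) := by
  have e : ∀ l : ℝ, Real.cos (h * l) * Real.cos (k * l) =
      2⁻¹ * (Real.cos ((h - k : ℤ) * l) + Real.cos ((h + k : ℤ) * l)) := fun l => by
    push_cast
    rw [sub_mul, add_mul, Real.cos_sub, Real.cos_add]; ring
  simp_rw [e]
  rw [intervalIntegral.integral_const_mul, intervalIntegral.integral_add
    (by apply Continuous.intervalIntegrable; fun_prop)
    (by apply Continuous.intervalIntegrable; fun_prop),
    integral_cos_int_mul, integral_cos_int_mul]
  have h1 : (h - k = 0) ↔ h = k := sub_eq_zero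
  have h2 : (h + k = 0) ↔ h = -k := add_eq_zero_iff_eq_neg
  simp only [h1, h2]
  split_ifs <;> ring

/-- Parseval's identity for trigonometric polynomials with real coefficients. -/
theorem integral_norm_sum_exp_sq (S : Finset ℤ) (w : ℤ → ℝ) :
    ∫ l in (-Real.pi)..Real.pi, ‖∑ s ∈ S, (w s : ℂ) * Complex.exp ((s * l : ℝ) * Complex.I)‖ ^ 2 =
      2 * Real.pi * ∑ s ∈ S, w s ^ 2 := by
  simp_rw [norm_sum_mul_exp_sq S w (fun s => (s : ℝ) * _)]
  rw [intervalIntegral.integral_finsetSum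
    (fun s _ => by apply Continuous.intervalIntegrable; fun_prop), Finset.mul_sum]
  refine Finset.sum_congr rfl fun s hs => ?_
  rw [intervalIntegral.integral_finsetSum
    (fun s _ => by apply Continuous.intervalIntegrable; fun_prop), Finset.sum_eq_single_of_mem s hs]
  · simp; ring
  · intro u _ hu
    have e : ∀ l : ℝ, Real.cos (s * l - u * l) = Real.cos ((s - u : ℤ) * l) := fun l => by
      push_cast; rw [sub_mul]
    simp_rw [e]
    rw [intervalIntegral.integral_const_mul, integral_cos_int_mul, if_neg (by omega), mul_zero]

/-- The Fejér kernel `n⁻¹ |∑_{t<n} exp(itλ)|²`. -/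
noncomputable def fejer (n : ℕ) (l : ℝ) : ℝ :=
  ‖∑ t ∈ Finset.range n, Complex.exp ((t * l : ℝ) * Complex.I)‖ ^ 2 / n

theorem fejer_nonneg (n : ℕ) (l : ℝ) : 0 ≤ fejer n l := by unfold fejer; positivity

theorem continuous_fejer (n : ℕ) : Continuous (fejer n) := by unfold fejer; fun_prop

theorem fejer_eq_sum_cos (n : ℕ) (l : ℝ) :
    fejer n l = (∑ t ∈ Finset.range n, ∑ u ∈ Finset.range n,
      Real.cos (((t : ℤ) - (u : ℤ) : ℤ) * l)) / n := by
  have := norm_sum_mul_exp_sq (Finset.range n) (fun _ => 1) (fun t => (t : ℝ) * l)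
  simp only [Complex.ofReal_one, one_mul] at this
  rw [fejer, this]
  congr 1
  refine Finset.sum_congr rfl fun s _ => Finset.sum_congr rfl fun u _ => ?_
  push_cast; rw [sub_mul]

theorem integral_mul_fejer {g : ℝ → ℝ} (hg : Continuous g) (n : ℕ) :
    ∫ l in (-Real.pi)..Real.pi, g l * fejer n l =
      (∑ t ∈ Finset.range n, ∑ u ∈ Finset.range n,
        ∫ l in (-Real.pi)..Real.pi, g l * Real.cos (((t : ℤ) - (u : ℤ) : ℤ) * l)) / n := by
  simp_rw [fejer_eq_sum_cos, ← mul_div_assoc]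
  rw [intervalIntegral.integral_div]
  congr 1
  simp_rw [Finset.mul_sum]
  rw [intervalIntegral.integral_finsetSum
    (fun s _ => by apply Continuous.intervalIntegrable; fun_prop)]
  refine Finset.sum_congr rfl fun s hs => ?_
  rw [intervalIntegral.integral_finsetSum
    (fun s _ => by apply Continuous.intervalIntegrable; fun_prop)]

theorem integral_fejer {n : ℕ} (hn : 1 ≤ n) :
    ∫ l in (-Real.pi)..Real.pi, fejer n l = 2 * Real.pi := by
  have := integral_mul_fejer (g := fun _ => 1) continuous_const n
  simp only [one_mul, integral_cos_int_mul] at this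
  rw [this]
  have hn' : (n : ℝ) ≠ 0 := by positivity
  have : ∀ t ∈ Finset.range n, ∑ u ∈ Finset.range n,
      (if (t : ℤ) - (u : ℤ) = 0 then 2 * Real.pi else 0) = 2 * Real.pi := fun t ht => by
    rw [Finset.sum_eq_single_of_mem t ht] <;> simp
    intro u _ hu h; omega
  rw [Finset.sum_congr rfl this]
  simp; field_simp

/-! ### Spectral density and the variance of the mean -/

theorem continuous_spectralDensity {γ : ℤ → ℝ} (hγ : Summable fun h => |γ h|) :
    Continuous (spectralDensity γ) := by
  unfold spectralDensity
  refine continuous_const.mul (continuous_tsum (fun h => by fun_prop) hγ fun h l => ?_)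
  rw [norm_mul, Real.norm_eq_abs]
  exact mul_le_of_le_one_right (abs_nonneg _) (Real.abs_cos_le_one _)

theorem integral_spectralDensity_mul_cos {γ : ℤ → ℝ} (hγ : Summable fun h => |γ h|)
    (heven : ∀ h, γ (-h) = γ h) (k : ℤ) :
    ∫ l in (-Real.pi)..Real.pi, spectralDensity γ l * Real.cos (k * l) = γ k := by
  have hs := intervalIntegral.hasSum_intervalIntegral_of_summable_norm (a := -Real.pi) (b := Real.pi)
    (f := fun h : ℤ => (⟨fun l : ℝ => (2 * Real.pi)⁻¹ * (γ h * Real.cos (h * l)) *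
      Real.cos (k * l), by fun_prop⟩ : C(ℝ, ℝ))) ?_
  · simp only [ContinuousMap.coe_mk] at hs
    have e : ∀ l : ℝ, ∑' h : ℤ, (2 * Real.pi)⁻¹ * (γ h * Real.cos (h * l)) * Real.cos (k * l) =
        spectralDensity γ l * Real.cos (k * l) := fun l => by
      rw [spectralDensity, tsum_mul_right, tsum_mul_left]
    simp_rw [e] at hs
    have e2 : ∀ h : ℤ, ∫ l in (-Real.pi)..Real.pi, (2 * Real.pi)⁻¹ * (γ h * Real.cos (h * l)) *
        -- The frequencies `k` and `-k` contribute half of `γ k` each; for `k = 0` both indicators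
        -- fire at the same index and the halves add up.
        Real.cos (k * l) = (if h = k then γ k / 2 else 0) + (if h = -k then γ k / 2 else 0) := by
      intro h
      have : ∀ l : ℝ, (2 * Real.pi)⁻¹ * (γ h * Real.cos (h * l)) * Real.cos (k * l) =
        ((2 * Real.pi)⁻¹ * γ h) * (Real.cos (h * l) * Real.cos (k * l)) := fun l => by ring
      simp_rw [this]
      rw [intervalIntegral.integral_const_mul, integral_cos_mul_cos]
      have hp := Real.pi_ne_zero
      rcases eq_or_ne h k with rfl | h1
      · split_ifs <;> field_simp <;> ring
      · rcases eq_or_ne h (-k) with rfl | h2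
        · rw [heven]; simp [h1]; field_simp
        · simp [h1, h2]
    simp_rw [e2] at hs
    have h3 := (hasSum_ite_eq k (γ k / 2)).add (hasSum_ite_eq (-k) (γ k / 2))
    rw [hs.unique h3]; ring
  · refine Summable.of_nonneg_of_le (fun _ => norm_nonneg _) (fun h => ?_)
      (hγ.mul_left (2 * Real.pi)⁻¹)
    rw [ContinuousMap.norm_le _ (by positivity)]
    intro l
    simp only [ContinuousMap.restrict_apply, ContinuousMap.coe_mk, norm_mul, Real.norm_eq_abs]
    rw [abs_of_pos (by positivity : 0 < (2 * Real.pi)⁻¹), mul_assoc]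
    gcongr
    have := Real.abs_cos_le_one (h * (l : ℝ))
    have := Real.abs_cos_le_one (k * (l : ℝ))
    rw [mul_assoc]
    exact mul_le_of_le_one_right (abs_nonneg _) (mul_le_one₀ ‹_› (abs_nonneg _) ‹_›)

/-- The Fejér kernel averages the Fourier coefficients over differences `t - u`, so this integral is
the variance of the scaled mean of the data. It makes data and bootstrap variances comparable as
integrals against one kernel. -/
theorem integral_spectralDensity_mul_fejer {γ : ℤ → ℝ} (hγ : Summable fun h => |γ h|)
    (heven : ∀ h, γ (-h) = γ h) (n : ℕ) :
    ∫ l in (-Real.pi)..Real.pi, spectralDensity γ l * fejer n l =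
      (∑ t ∈ Finset.range n, ∑ u ∈ Finset.range n, γ ((t : ℤ) - (u : ℤ))) / n := by
  rw [integral_mul_fejer (continuous_spectralDensity hγ)]
  simp_rw [integral_spectralDensity_mul_cos hγ heven]

theorem two_pi_mul_spectralDensity_zero (γ : ℤ → ℝ) :
    2 * Real.pi * spectralDensity γ 0 = ∑' h, γ h := by
  simp [spectralDensity]
  field_simp

/-- Grouping the pairs by their difference `h` weights `γ h` by the proportion of `t < n` with `t -
h` in range. This weight lies in `[0, 1]` and tends to `1`, so dominated convergence applies. -/
theorem tendsto_cesaro_double_sum {γ : ℤ → ℝ} (hγ : Summable fun h => |γ h|) :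
    Tendsto (fun n : ℕ => (∑ t ∈ Finset.range n, ∑ u ∈ Finset.range n,
      γ ((t : ℤ) - (u : ℤ))) / n) atTop (𝓝 (∑' h, γ h)) := by
  let κ : ℕ → ℤ → ℝ := fun n h =>
    (∑ t ∈ Finset.range n, if (0 : ℤ) ≤ t - h ∧ (t : ℤ) - h < n then (1 : ℝ) else 0) / n
  have hinner : ∀ (n : ℕ) (t : ℕ), HasSum
      (fun h : ℤ => γ h * if (0 : ℤ) ≤ t - h ∧ (t : ℤ) - h < n then (1 : ℝ) else 0)
      (∑ u ∈ Finset.range n, γ ((t : ℤ) - (u : ℤ))) := by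
    intro n t
    have hinj : Set.InjOn (fun u : ℕ => (t : ℤ) - u) (Finset.range n : Set ℕ) :=
      fun a _ b _ h => by simpa using h
    have : ∑ u ∈ Finset.range n, γ ((t : ℤ) - (u : ℤ)) =
        ∑ h ∈ (Finset.range n).image (fun u : ℕ => (t : ℤ) - u),
          γ h * if (0 : ℤ) ≤ t - h ∧ (t : ℤ) - h < n then (1 : ℝ) else 0 := by
      rw [Finset.sum_image hinj]
      refine Finset.sum_congr rfl fun u hu => ?_
      have := Finset.mem_range.1 hu
      rw [if_pos (by omega), mul_one]
    rw [this]
    refine hasSum_sum_of_ne_finset_zero fun h hh => ?_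
    rw [if_neg, mul_zero]
    rintro ⟨h1, h2⟩
    refine hh (Finset.mem_image.2 ⟨((t : ℤ) - h).toNat, ?_, ?_⟩)
    · rw [Finset.mem_range]; omega
    · omega
  have hκ : ∀ n : ℕ, (∑ t ∈ Finset.range n, ∑ u ∈ Finset.range n,
      γ ((t : ℤ) - (u : ℤ))) / n = ∑' h, γ h * κ n h := by
    intro n
    have := (hasSum_sum (fun t (_ : t ∈ Finset.range n) => hinner n t)).div_const (n : ℝ)
    rw [← this.tsum_eq]
    refine tsum_congr fun h => ?_
    simp only [κ]
    rw [← Finset.mul_sum, mul_div_assoc]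
  simp_rw [hκ]
  have hκ0 : ∀ n h, 0 ≤ κ n h := fun n h => by
    simp only [κ]
    refine div_nonneg (Finset.sum_nonneg fun t _ => ?_) (Nat.cast_nonneg _)
    split_ifs <;> norm_num
  have hκ1 : ∀ n h, κ n h ≤ 1 := fun n h => by
    refine div_le_one_of_le₀ ?_ (Nat.cast_nonneg _)
    calc _ ≤ ∑ t ∈ Finset.range n, (1 : ℝ) :=
          Finset.sum_le_sum fun t _ => by split_ifs <;> norm_num
      _ = n := by simp
  refine tendsto_tsum_of_dominated_convergence (bound := fun h => |γ h|) hγ (fun h => ?_)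
    (Eventually.of_forall fun n h => ?_)
  · have hlow : ∀ᶠ n : ℕ in atTop, 1 - |(h : ℝ)| / n ≤ κ n h := by
      filter_upwards [eventually_ge_atTop 1] with n hn
      have hn' : (0 : ℝ) < n := by positivity
      have key : (n : ℝ) - |(h : ℝ)| ≤
          ∑ t ∈ Finset.range n, if (0 : ℤ) ≤ t - h ∧ (t : ℤ) - h < n then (1 : ℝ) else 0 := by
        rw [Finset.sum_boole]
        -- These `t` satisfy both range conditions; when `|h| ≤ n` there are exactly `n - |h|` of
        -- them.
        have hsub : Finset.Ico (max h 0).toNat (min (n : ℤ) (n + h)).toNat ⊆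
            (Finset.range n).filter (fun t : ℕ => (0 : ℤ) ≤ t - h ∧ (t : ℤ) - h < n) := by
          intro t ht
          simp only [Finset.mem_Ico, Finset.mem_filter, Finset.mem_range] at ht ⊢
          omega
        have hc := Finset.card_le_card hsub
        rw [Nat.card_Ico] at hc
        have : (n : ℤ) - |h| ≤ ((Finset.range n).filter
            (fun t : ℕ => (0 : ℤ) ≤ t - h ∧ (t : ℤ) - h < n)).card := by
          rcases abs_cases h with ⟨h1, _⟩ | ⟨h1, _⟩ <;> omega
        exact_mod_cast this
      calc 1 - |(h : ℝ)| / n = ((n : ℝ) - |(h : ℝ)|) / n := by field_simp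
        _ ≤ κ n h := by simp only [κ]; gcongr
    have hlim : Tendsto (fun n : ℕ => 1 - |(h : ℝ)| / n) atTop (𝓝 1) := by
      simpa using (tendsto_const_div_atTop_nhds_zero_nat |(h : ℝ)|).const_sub 1
    have : Tendsto (fun n => κ n h) atTop (𝓝 1) :=
      tendsto_of_tendsto_of_tendsto_of_le_of_le' hlim tendsto_const_nhds hlow
        (Eventually.of_forall fun n => hκ1 n h)
    simpa using this.const_mul (γ h)
  · rw [norm_mul, Real.norm_eq_abs, Real.norm_eq_abs, abs_of_nonneg (hκ0 n h)]
    exact mul_le_of_le_one_right (abs_nonneg _) (hκ1 n h)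

/-! ### The exponential recursion for power series -/

theorem summable_coeff_mul_pow {b : ℕ → ℂ} {M : ℝ} (hb : ∀ k, ‖b k‖ ≤ M) {z : ℂ} (hz : ‖z‖ < 1) :
    Summable fun k => ‖b k * z ^ k‖ := by
  refine Summable.of_nonneg_of_le (fun _ => norm_nonneg _) (fun k => ?_)
    ((summable_geometric_of_lt_one (norm_nonneg z) hz).mul_left M)
  rw [norm_mul, norm_pow]
  exact mul_le_mul_of_nonneg_right (hb k) (by positivity)

theorem summable_succ_coeff_mul_pow {b : ℕ → ℂ} {M : ℝ} (hb : ∀ k, ‖b k‖ ≤ M) {z : ℂ}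
    (hz : ‖z‖ < 1) : Summable fun k : ℕ => ‖((k : ℂ) + 1) * b (k + 1) * z ^ k‖ := by
  have h1 := summable_pow_mul_geometric_of_norm_lt_one (R := ℝ) 1 (r := ‖z‖) (by simpa using hz)
  have h2 := summable_geometric_of_lt_one (norm_nonneg z) hz
  refine Summable.of_nonneg_of_le (fun _ => norm_nonneg _) (fun k => ?_) ((h1.add h2).mul_left M)
  rw [norm_mul, norm_mul, norm_pow]
  have h3 : ‖(k : ℂ) + 1‖ = k + 1 := by
    have : ((k : ℂ) + 1) = ((k + 1 : ℕ) : ℂ) := by push_cast; rfl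
    rw [this, Complex.norm_natCast]; push_cast; rfl
  have h4 : 0 ≤ ‖z‖ ^ k := by positivity
  rw [h3]
  have := mul_le_mul_of_nonneg_right (mul_le_mul_of_nonneg_left (hb (k + 1))
    (by positivity : (0 : ℝ) ≤ k + 1)) h4
  nlinarith

theorem hasDerivAt_tsum_coeff_mul_pow {b : ℕ → ℂ} {M : ℝ} (hb : ∀ k, ‖b k‖ ≤ M) {z : ℂ}
    (hz : ‖z‖ < 1) :
    HasDerivAt (fun y => ∑' k, b k * y ^ k) (∑' k : ℕ, ((k : ℂ) + 1) * b (k + 1) * z ^ k) z := by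
  -- On a disc of radius strictly below `1` the differentiated series has a summable majorant.
  obtain ⟨ρ, hzρ, hρ⟩ := exists_between hz
  have hρ0 : 0 < ρ := (norm_nonneg z).trans_lt hzρ
  have hu : Summable fun k : ℕ => ‖b k * (k * (ρ : ℂ) ^ (k - 1))‖ := by
    rw [← summable_nat_add_iff 1]
    refine (summable_succ_coeff_mul_pow hb (z := (ρ : ℂ)) ?_).congr fun k => ?_
    · rwa [Complex.norm_real, Real.norm_of_nonneg hρ0.le]
    · simp only [Nat.add_sub_cancel]; push_cast; congr 1; ring
  have hmain := hasDerivAt_tsum_of_isPreconnected (𝕜 := ℂ) (t := Metric.ball 0 ρ)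
    (g := fun k y => b k * y ^ k) (g' := fun k y => b k * (k * y ^ (k - 1))) (y₀ := 0) (y := z)
    hu Metric.isOpen_ball (convex_ball _ _).isPreconnected
    (fun k y _ => (hasDerivAt_pow k y).const_mul _) ?_ (Metric.mem_ball_self hρ0) ?_
    (by simpa using hzρ)
  · refine hmain.congr_deriv ?_
    have hs : Summable fun k : ℕ => b k * (k * z ^ (k - 1)) := by
      refine Summable.of_norm_bounded hu fun k => ?_
      simp only [norm_mul, norm_pow, Complex.norm_real, Real.norm_of_nonneg hρ0.le]
      gcongr
    rw [hs.tsum_eq_zero_add]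
    simp only [Nat.cast_zero, zero_mul, mul_zero, zero_add, Nat.add_sub_cancel]
    refine tsum_congr fun k => ?_
    push_cast; ring
  · intro k y hy
    simp only [Metric.mem_ball, dist_zero_right] at hy
    simp only [norm_mul, norm_pow, Complex.norm_real, Real.norm_of_nonneg hρ0.le]
    gcongr
  · exact (summable_coeff_mul_pow hb (z := 0) (by simp)).of_norm

/-- If `(k+1) c_{k+1} = ∑ (i+1) a_{i+1} c_j` over `i + j = k` and `c_0 = 1`, then
`∑ c_k z^k = exp (∑_{k ≥ 1} a_k z^k)` on the unit disc. -/
theorem tsum_eq_exp_of_recursion {a c : ℕ → ℂ} {M N : ℝ} (ha : ∀ k, ‖a k‖ ≤ M)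
    (hc : ∀ k, ‖c k‖ ≤ N) (hc0 : c 0 = 1)
    (hrec : ∀ k : ℕ, ((k : ℂ) + 1) * c (k + 1) =
      ∑ p ∈ Finset.HasAntidiagonal.antidiagonal k, ((p.1 : ℂ) + 1) * a (p.1 + 1) * c p.2)
    {z : ℂ} (hz : ‖z‖ < 1) :
    ∑' k, c k * z ^ k = Complex.exp (∑' k, a k * z ^ k - a 0) := by
  let G : ℂ → ℂ := fun y => ∑' k, c k * y ^ k
  let A : ℂ → ℂ := fun y => ∑' k, a k * y ^ k
  -- The recursion is the coefficient form of `G' = A' G`, so `G exp(-A)` is constant. At `0` it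
  -- equals `exp(-a 0)`, whence the correction by `a 0` in the conclusion.
  have hder : ∀ y ∈ Metric.ball (0 : ℂ) 1,
      HasDerivAt (fun y => G y * Complex.exp (-A y)) 0 y := by
    intro y hy
    have hy' : ‖y‖ < 1 := by simpa using hy
    have hG := hasDerivAt_tsum_coeff_mul_pow hc hy'
    have hA := hasDerivAt_tsum_coeff_mul_pow ha hy'
    have hprod : ∑' k : ℕ, ((k : ℂ) + 1) * c (k + 1) * y ^ k =
        (∑' k : ℕ, ((k : ℂ) + 1) * a (k + 1) * y ^ k) * G y := by
      simp only [G]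
      rw [tsum_mul_tsum_eq_tsum_sum_antidiagonal_of_summable_norm
        (summable_succ_coeff_mul_pow ha hy') (summable_coeff_mul_pow hc hy')]
      refine tsum_congr fun k => ?_
      rw [hrec, Finset.sum_mul]
      refine Finset.sum_congr rfl fun p hp => ?_
      rw [← Finset.HasAntidiagonal.mem_antidiagonal.1 hp, pow_add]; ring
    refine (hG.mul hA.neg.cexp).congr_deriv ?_
    rw [hprod]
    simp only [G]; ring
  have hconst := IsOpen.is_const_of_deriv_eq_zero (𝕜 := ℂ) Metric.isOpen_ball
    (convex_ball (0 : ℂ) 1).isPreconnected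
    (fun y hy => (hder y hy).differentiableAt.differentiableWithinAt)
    (fun y hy => (hder y hy).deriv) (x := z) (y := 0) (by simpa using hz) (by simp)
  have h0 : ∀ b : ℕ → ℂ, ∑' k, b k * (0 : ℂ) ^ k = b 0 := fun b => by
    rw [tsum_eq_single 0 fun k hk => by simp [hk]]; simp
  simp only [G, A, h0, hc0, one_mul] at hconst
  rw [sub_eq_add_neg, Complex.exp_add, ← hconst, mul_left_comm, ← Complex.exp_add, add_neg_cancel,
    Complex.exp_zero, mul_one]

/-! ### The Poisson kernel -/

/-- Closed form of `1 + 2 ∑_{k ≥ 1} r^k cos(kθ)` for `0 ≤ r < 1`, normalized to have integral `2π`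
over a period. -/
noncomputable def poissonKer (r θ : ℝ) : ℝ := (1 - r ^ 2) / (1 - 2 * r * Real.cos θ + r ^ 2)

theorem poissonKer_denom_pos {r : ℝ} (h0 : 0 ≤ r) (h1 : r < 1) (θ : ℝ) :
    0 < 1 - 2 * r * Real.cos θ + r ^ 2 := by
  nlinarith [Real.cos_le_one θ, mul_nonneg h0 (sub_nonneg.2 (Real.cos_le_one θ)),
    sq_pos_of_pos (sub_pos.2 h1)]

theorem poissonKer_nonneg {r : ℝ} (h0 : 0 ≤ r) (h1 : r < 1) (θ : ℝ) : 0 ≤ poissonKer r θ :=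
  div_nonneg (by nlinarith) (poissonKer_denom_pos h0 h1 θ).le

theorem continuous_poissonKer {r : ℝ} (h0 : 0 ≤ r) (h1 : r < 1) : Continuous (poissonKer r) :=
  Continuous.div (by fun_prop) (by fun_prop) fun θ => (poissonKer_denom_pos h0 h1 θ).ne'

theorem hasSum_pow_mul_cos {r : ℝ} (h0 : 0 ≤ r) (h1 : r < 1) (θ : ℝ) :
    HasSum (fun k : ℕ => r ^ k * Real.cos (k * θ)) ((1 + poissonKer r θ) / 2) := by
  have hz : ‖(r : ℂ) * Complex.exp (θ * Complex.I)‖ < 1 := by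
    rw [norm_mul, Complex.norm_exp_ofReal_mul_I, Complex.norm_real, Real.norm_of_nonneg h0]
    simpa using h1
  have hs := Complex.hasSum_re (hasSum_geometric_of_norm_lt_one hz)
  have hden := poissonKer_denom_pos h0 h1 θ
  convert hs using 1
  · funext k
    have : ((r : ℂ) * Complex.exp (θ * Complex.I)) ^ k =
        ((r ^ k : ℝ) : ℂ) * Complex.exp ((k * θ : ℝ) * Complex.I) := by
      rw [mul_pow, ← Complex.exp_nat_mul]; push_cast; ring_nf
    rw [this, Complex.re_ofReal_mul, Complex.exp_ofReal_mul_I_re]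
  · rw [Complex.inv_re, Complex.normSq_apply]
    simp only [Complex.sub_re, Complex.one_re, Complex.re_ofReal_mul, Complex.exp_ofReal_mul_I_re,
      Complex.sub_im, Complex.one_im, Complex.im_ofReal_mul, Complex.exp_ofReal_mul_I_im]
    have e : (1 - r * Real.cos θ) * (1 - r * Real.cos θ) +
        (0 - r * Real.sin θ) * (0 - r * Real.sin θ) = 1 - 2 * r * Real.cos θ + r ^ 2 := by
      have := Real.sin_sq_add_cos_sq θ
      linear_combination r ^ 2 * this
    rw [e, poissonKer, div_eq_div_iff two_ne_zero hden.ne', add_mul, div_mul_cancel₀ _ hden.ne']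
    ring

theorem hasSum_pow_mul_integral_cos {r : ℝ} (h0 : 0 ≤ r) (h1 : r < 1) {h : ℝ → ℝ}
    (hh : IntervalIntegrable h volume (-Real.pi) Real.pi) :
    HasSum (fun k : ℕ => r ^ k * ∫ θ in (-Real.pi)..Real.pi, h θ * Real.cos (k * θ))
      (((∫ θ in (-Real.pi)..Real.pi, h θ) +
        ∫ θ in (-Real.pi)..Real.pi, h θ * poissonKer r θ) / 2) := by
  have hmain := intervalIntegral.hasSum_integral_of_dominated_convergence (a := -Real.pi)
    (b := Real.pi) (μ := volume) (F := fun (k : ℕ) θ => r ^ k * (h θ * Real.cos (k * θ)))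
    (f := fun θ => h θ * ((1 + poissonKer r θ) / 2)) (fun k θ => r ^ k * |h θ|) ?_ ?_ ?_ ?_ ?_
  · simp_rw [intervalIntegral.integral_const_mul] at hmain
    rw [← intervalIntegral.integral_add hh
      (hh.mul_continuousOn (continuous_poissonKer h0 h1).continuousOn),
      ← intervalIntegral.integral_div]
    have e : ∀ θ, (h θ + h θ * poissonKer r θ) / 2 = h θ * ((1 + poissonKer r θ) / 2) :=
      fun θ => by ring
    simpa only [e] using hmain
  · intro k
    exact (intervalIntegrable_iff.1 ((hh.mul_continuousOn (by fun_prop : Continuous fun θ : ℝ =>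
      Real.cos (k * θ)).continuousOn).const_mul _)).aestronglyMeasurable
  · refine fun k => Eventually.of_forall fun θ _ => ?_
    rw [norm_mul, norm_pow, Real.norm_of_nonneg h0, norm_mul, Real.norm_eq_abs, Real.norm_eq_abs]
    have := Real.abs_cos_le_one (k * θ)
    gcongr
    exact mul_le_of_le_one_right (abs_nonneg _) this
  · exact Eventually.of_forall fun θ _ => (summable_geometric_of_lt_one h0 h1).mul_right _
  · simp_rw [tsum_mul_right]
    exact hh.abs.const_mul _
  · refine Eventually.of_forall fun θ _ => ?_
    refine ((hasSum_pow_mul_cos h0 h1 θ).mul_left (h θ)).congr_fun fun k => ?_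
    ring

theorem integral_poissonKer {r : ℝ} (h0 : 0 ≤ r) (h1 : r < 1) :
    ∫ θ in (-Real.pi)..Real.pi, poissonKer r θ = 2 * Real.pi := by
  have hs := hasSum_pow_mul_integral_cos h0 h1 (h := fun _ => 1) intervalIntegrable_const
  have hs' : HasSum (fun k : ℕ => r ^ k * ∫ θ in (-Real.pi)..Real.pi, 1 * Real.cos (k * θ))
      (2 * Real.pi) := by
    have e : ∀ k : ℕ, r ^ k * ∫ θ in (-Real.pi)..Real.pi, 1 * Real.cos (k * θ) =
        if k = 0 then 2 * Real.pi else 0 := fun k => by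
      have := integral_cos_int_mul k
      simp only [Int.cast_natCast, Nat.cast_eq_zero] at this
      simp only [one_mul, this]
      split_ifs with hk <;> simp [hk]
    simp_rw [e]
    exact hasSum_ite_eq 0 _
  have := hs.unique hs'
  simp only [one_mul, intervalIntegral.integral_const, smul_eq_mul, mul_one] at this
  linarith

/-- The kernel is nonnegative, has total mass `2π` and tends to `0` uniformly away from the origin.
Integrability and a limit at `0` suffice, so a logarithm may be singular elsewhere. -/
theorem tendsto_integral_mul_poissonKer {h : ℝ → ℝ} {a : ℝ}
    (hh : IntervalIntegrable h volume (-Real.pi) Real.pi) (ha : Tendsto h (𝓝 0) (𝓝 a)) :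
    Tendsto (fun r => (2 * Real.pi)⁻¹ * ∫ θ in (-Real.pi)..Real.pi, h θ * poissonKer r θ)
      (𝓝[<] 1) (𝓝 a) := by
  have hpi := Real.pi_pos
  have hle : -Real.pi ≤ Real.pi := by linarith
  -- Beyond `1/2`, the denominator `(1 - r)² + 2r(1 - cos θ)` is at least `1 - cos θ`, a bound free
  -- of `r`.
  have hr : ∀ᶠ r : ℝ in 𝓝[<] 1, 1 / 2 < r ∧ r < 1 :=
    Ioo_mem_nhdsLT (by norm_num)
  have key := tendsto_setIntegral_peak_smul_of_integrableOn_of_tendsto (μ := volume)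
    (s := Ioc (-Real.pi) Real.pi) (t := Ioc (-Real.pi) Real.pi) (x₀ := (0 : ℝ)) (g := h) (a := a)
    (l := 𝓝[<] (1 : ℝ)) (φ := fun r θ => (2 * Real.pi)⁻¹ * poissonKer r θ)
    measurableSet_Ioc measurableSet_Ioc subset_rfl self_mem_nhdsWithin (by simp) ?_ ?_ ?_ ?_
    ((intervalIntegrable_iff_integrableOn_Ioc_of_le hle).1 hh) (ha.mono_left nhdsWithin_le_nhds)
  · refine key.congr fun r => ?_
    rw [intervalIntegral.integral_of_le hle, ← integral_const_mul]
    refine integral_congr_ae (Eventually.of_forall fun θ => ?_)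
    simp only [smul_eq_mul]; ring
  · filter_upwards [hr] with r hr θ _
    exact mul_nonneg (by positivity) (poissonKer_nonneg (by linarith) hr.2 θ)
  · intro u hu h0u
    obtain ⟨η, hη, hball⟩ := Metric.isOpen_iff.1 hu 0 h0u
    -- The cap at `π` keeps the comparison of cosines within the range where cosine decreases.
    let η' := min η Real.pi
    have hη' : 0 < η' := lt_min hη hpi
    have hcos : Real.cos η' < 1 := by
      rw [← Real.cos_zero]
      exact Real.cos_lt_cos_of_nonneg_of_le_pi le_rfl (min_le_right _ _) hη'
    rw [Metric.tendstoUniformlyOn_iff]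
    intro ε hε
    have hlim : Tendsto (fun r : ℝ => (2 * Real.pi)⁻¹ * ((1 - r ^ 2) / (1 - Real.cos η')))
        (𝓝[<] 1) (𝓝 0) := by
      have : Continuous fun r : ℝ => (2 * Real.pi)⁻¹ * ((1 - r ^ 2) / (1 - Real.cos η')) := by
        fun_prop
      have h2 := this.tendsto 1
      simp only [one_pow, sub_self, zero_div, mul_zero] at h2
      exact h2.mono_left nhdsWithin_le_nhds
    filter_upwards [hr, hlim.eventually (gt_mem_nhds hε)] with r hr hsmall θ hθ
    have hnn := poissonKer_nonneg (by linarith) hr.2 θ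
    simp only [Pi.zero_apply, dist_zero_left]
    rw [Real.norm_of_nonneg (by positivity)]
    refine lt_of_le_of_lt ?_ hsmall
    have hθη : η' ≤ |θ| := by
      by_contra hlt
      exact hθ.2 (hball (by simpa using (not_le.1 hlt).trans_le (min_le_left _ _)))
    have hθpi : |θ| ≤ Real.pi := abs_le.2 ⟨hθ.1.1.le, hθ.1.2⟩
    have hcosθ : Real.cos θ ≤ Real.cos η' := by
      rw [← Real.cos_abs θ]
      exact Real.cos_le_cos_of_nonneg_of_le_pi hη'.le hθpi hθη
    unfold poissonKer
    gcongr
    · nlinarith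
    · nlinarith [sq_nonneg (1 - r), mul_nonneg (by linarith : (0 : ℝ) ≤ 2 * r - 1)
        (sub_nonneg.2 (Real.cos_le_one η')), mul_nonneg (by linarith : (0 : ℝ) ≤ 2 * r)
        (sub_nonneg.2 hcosθ)]
  · refine tendsto_const_nhds.congr' ?_
    filter_upwards [hr] with r hr
    rw [integral_const_mul, ← intervalIntegral.integral_of_le hle,
      integral_poissonKer (by linarith) hr.2]
    field_simp
  · filter_upwards [hr] with r hr
    exact ((continuous_poissonKer (by linarith) hr.2).const_smul
      (2 * Real.pi)⁻¹).aestronglyMeasurable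

/-! ### The Wold coefficients factorize the spectral density -/

theorem abs_logFourier_le (g : ℝ → ℝ) (hg : LogIntegrable g) (k : ℕ) :
    |logFourier g k| ≤ (2 * Real.pi)⁻¹ * ∫ l in (-Real.pi)..Real.pi, |Real.log (g l)| := by
  have hpi := Real.pi_pos
  have hle : -Real.pi ≤ Real.pi := by linarith
  have hint : IntervalIntegrable (fun l => Real.log (g l)) volume (-Real.pi) Real.pi :=
    (intervalIntegrable_iff_integrableOn_Ioc_of_le hle).2 hg.2
  rw [logFourier, abs_mul, abs_of_pos (by positivity)]
  gcongr
  refine (intervalIntegral.abs_integral_le_integral_abs hle).trans ?_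
  refine intervalIntegral.integral_mono_on hle
    (hint.mul_continuousOn (by fun_prop : Continuous fun l : ℝ => Real.cos (k * l)).continuousOn).abs
    hint.abs fun l _ => ?_
  rw [abs_mul]
  exact mul_le_of_le_one_right (abs_nonneg _) (Real.abs_cos_le_one _)

/-- Periodicity moves the shift onto the cosine, and the sine coefficient vanishes because `log g`
is even. Hence the Abel sum of these integrals can be read both as a real part of `∑ a_k z^k` and as
a Poisson integral of `log g` around `l`. -/
theorem integral_log_shift_mul_cos {g : ℝ → ℝ} (hs : IsSpectralShape g) (hg : LogIntegrable g)
    (k : ℕ) (l : ℝ) :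
    ∫ θ in (-Real.pi)..Real.pi, Real.log (g (θ + l)) * Real.cos (k * θ) =
      2 * Real.pi * (logFourier g k * Real.cos (k * l)) := by
  have hpi := Real.pi_pos
  have hle : -Real.pi ≤ Real.pi := by linarith
  have hint : IntervalIntegrable (fun l => Real.log (g l)) volume (-Real.pi) Real.pi :=
    (intervalIntegrable_iff_integrableOn_Ioc_of_le hle).2 hg.2
  let F : ℝ → ℝ := fun u => Real.log (g u) * Real.cos (k * (u - l))
  have hF : Function.Periodic F (2 * Real.pi) := fun u => by
    simp only [F]
    rw [hs.periodic u, show (k : ℝ) * (u + 2 * Real.pi - l) = k * (u - l) + k * (2 * Real.pi) by ring,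
      Real.cos_add_nat_mul_two_pi]
  have h1 : ∫ θ in (-Real.pi)..Real.pi, Real.log (g (θ + l)) * Real.cos (k * θ) =
      ∫ u in (-Real.pi)..Real.pi, F u := by
    have e : ∀ θ, Real.log (g (θ + l)) * Real.cos (k * θ) = F (θ + l) := fun θ => by simp [F]
    simp_rw [e]
    rw [intervalIntegral.integral_comp_add_right]
    have := hF.intervalIntegral_add_eq (-Real.pi + l) (-Real.pi)
    rwa [show -Real.pi + l + 2 * Real.pi = Real.pi + l by ring,
      show -Real.pi + 2 * Real.pi = Real.pi by ring] at this
  have hsin : ∫ u in (-Real.pi)..Real.pi, Real.log (g u) * Real.sin (k * u) = 0 := by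
    have := intervalIntegral.integral_comp_neg (a := -Real.pi) (b := Real.pi)
      (fun u => Real.log (g u) * Real.sin (k * u))
    simp only [hs.even, mul_neg, Real.sin_neg, intervalIntegral.integral_neg, neg_neg] at this
    linarith
  have e2 : ∀ u, F u = Real.cos (k * l) * (Real.log (g u) * Real.cos (k * u)) +
      Real.sin (k * l) * (Real.log (g u) * Real.sin (k * u)) := fun u => by
    simp only [F]; rw [mul_sub, Real.cos_sub]; ring
  rw [h1]
  simp_rw [e2]
  rw [intervalIntegral.integral_add, intervalIntegral.integral_const_mul,
    intervalIntegral.integral_const_mul, hsin, logFourier]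
  · field_simp; ring
  · exact (hint.mul_continuousOn
      (by fun_prop : Continuous fun u : ℝ => Real.cos (k * u)).continuousOn).const_mul _
  · exact (hint.mul_continuousOn
      (by fun_prop : Continuous fun u : ℝ => Real.sin (k * u)).continuousOn).const_mul _

theorem woldCoeff_zero (g : ℝ → ℝ) : woldCoeff g 0 = 1 := by rw [woldCoeff]

/-- Multiplication by `k + 1` turns the weight `1 - j/(k+1)` into `k + 1 - j`, the factor produced
by differentiating a power series. -/
theorem woldCoeff_recursion (g : ℝ → ℝ) (k : ℕ) :
    ((k : ℝ) + 1) * woldCoeff g (k + 1) = ∑ p ∈ Finset.HasAntidiagonal.antidiagonal k,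
      ((p.1 : ℝ) + 1) * logFourier g (p.1 + 1) * woldCoeff g p.2 := by
  rw [← Finset.Nat.sum_antidiagonal_swap, Finset.Nat.sum_antidiagonal_eq_sum_range_succ_mk,
    woldCoeff, Finset.mul_sum,
    Finset.sum_range (n := k.succ)]
  refine Finset.sum_congr rfl fun j _ => ?_
  have hj : (j : ℕ) ≤ k := Nat.lt_succ_iff.1 j.2
  have hk : (k : ℝ) + 1 ≠ 0 := by positivity
  simp only [Prod.swap_prod_mk]
  rw [show k + 1 - (j : ℕ) = k - j + 1 by omega, Nat.cast_sub hj]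
  field_simp
  ring

/-- The transfer function `∑ c_k exp(ikλ)` of a linear filter. -/
noncomputable def transfer (c : ℕ → ℝ) (l : ℝ) : ℂ :=
  ∑' k : ℕ, (c k : ℂ) * Complex.exp ((k * l : ℝ) * Complex.I)

/-- At `z = r exp(il)` one has `|∑ c_k z^k|² = exp(2 Re ∑_{k ≥ 1} a_k z^k)`, with exponent the
Poisson integral of `log g` at `l` minus `a_0`. As `r` tends to `1`, absolute summability gives the
boundary value on the left and continuity of `log g` at `l` the one on the right. The factor
`exp(-a_0)` cancels against the innovation variance. -/
theorem innovVar_mul_norm_transfer_sq {g : ℝ → ℝ} (hs : IsSpectralShape g) (hg : LogIntegrable g)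
    (hcont : Continuous g) (hc : Summable fun k => |woldCoeff g k|) {l : ℝ} (hl : 0 < g l) :
    innovVar g * ‖transfer (woldCoeff g) l‖ ^ 2 = 2 * Real.pi * g l := by
  have hpi := Real.pi_pos
  have hle : -Real.pi ≤ Real.pi := by linarith
  have hint : IntervalIntegrable (fun l => Real.log (g l)) volume (-Real.pi) Real.pi :=
    (intervalIntegrable_iff_integrableOn_Ioc_of_le hle).2 hg.2
  have hper : Function.Periodic (fun l => Real.log (g l)) (2 * Real.pi) := fun u => by
    simp only [hs.periodic u]
  have hintl : IntervalIntegrable (fun θ => Real.log (g (θ + l))) volume (-Real.pi) Real.pi := by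
    have h1 := hper.intervalIntegrable (t := -Real.pi) (by positivity)
      (by rwa [show -Real.pi + 2 * Real.pi = Real.pi by ring]) (-Real.pi + l) (Real.pi + l)
    simpa using h1.comp_add_right l
  have hlim1 : Tendsto (fun r => (2 * Real.pi)⁻¹ * ∫ θ in (-Real.pi)..Real.pi,
      Real.log (g (θ + l)) * poissonKer r θ) (𝓝[<] 1) (𝓝 (Real.log (g l))) := by
    refine tendsto_integral_mul_poissonKer hintl ?_
    have h1 : ContinuousAt (fun θ => Real.log (g (θ + l))) 0 := by
      refine ContinuousAt.log (by fun_prop) ?_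
      simpa using hl.ne'
    simpa [ContinuousAt] using h1
  have hr : ∀ᶠ r : ℝ in 𝓝[<] 1, 0 < r ∧ r < 1 := Ioo_mem_nhdsLT (by norm_num)
  -- the modulus of the power series inside the disc
  have hdisc : ∀ r : ℝ, 0 < r → r < 1 →
      ‖∑' k : ℕ, (woldCoeff g k : ℂ) * ((r : ℂ) * Complex.exp (l * Complex.I)) ^ k‖ ^ 2 =
        Real.exp (-logFourier g 0 + (2 * Real.pi)⁻¹ * ∫ θ in (-Real.pi)..Real.pi,
          Real.log (g (θ + l)) * poissonKer r θ) := by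
    intro r h0 h1
    have hz : ‖(r : ℂ) * Complex.exp (l * Complex.I)‖ < 1 := by
      rw [norm_mul, Complex.norm_exp_ofReal_mul_I, Complex.norm_real, Real.norm_of_nonneg h0.le]
      simpa using h1
    have haM : ∀ k, ‖(logFourier g k : ℂ)‖ ≤
        (2 * Real.pi)⁻¹ * ∫ l in (-Real.pi)..Real.pi, |Real.log (g l)| := fun k => by
      rw [Complex.norm_real]; exact abs_logFourier_le g hg k
    have hcN : ∀ k, ‖(woldCoeff g k : ℂ)‖ ≤ ∑' k, |woldCoeff g k| := fun k => by
      rw [Complex.norm_real]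
      exact hc.le_tsum k fun _ _ => abs_nonneg _
    rw [tsum_eq_exp_of_recursion haM hcN (by simp [woldCoeff_zero])
      (fun k => by exact_mod_cast woldCoeff_recursion g k) hz, Complex.norm_exp, ← Real.exp_nat_mul]
    congr 1
    -- The sum from `k = 0` has real part half of `a_0` plus the Poisson integral; subtracting `a_0`
    -- and doubling leaves the Poisson integral minus `a_0`.
    have hS := Complex.hasSum_re (summable_coeff_mul_pow haM hz).of_norm.hasSum
    have hT := hasSum_pow_mul_integral_cos h0.le h1 hintl
    simp_rw [integral_log_shift_mul_cos hs hg] at hT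
    have hT0 := integral_log_shift_mul_cos hs hg 0 l
    simp only [Nat.cast_zero, zero_mul, Real.cos_zero, mul_one] at hT0
    rw [hT0] at hT
    have hterm : ∀ k : ℕ,
        ((logFourier g k : ℂ) * ((r : ℂ) * Complex.exp (l * Complex.I)) ^ k).re =
          (2 * Real.pi)⁻¹ * (r ^ k * (2 * Real.pi * (logFourier g k * Real.cos (k * l)))) := by
      intro k
      have : ((r : ℂ) * Complex.exp (l * Complex.I)) ^ k =
          ((r ^ k : ℝ) : ℂ) * Complex.exp ((k * l : ℝ) * Complex.I) := by
        rw [mul_pow, ← Complex.exp_nat_mul]; push_cast; ring_nf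
      rw [this, Complex.re_ofReal_mul, Complex.re_ofReal_mul, Complex.exp_ofReal_mul_I_re]
      field_simp
    simp_rw [hterm] at hS
    have := hS.unique (hT.mul_left _)
    rw [Complex.sub_re, this, Complex.ofReal_re]
    field_simp
    push_cast
    ring
  -- passing to the boundary
  have hlim2 : Tendsto (fun r : ℝ =>
      ‖∑' k : ℕ, (woldCoeff g k : ℂ) * ((r : ℂ) * Complex.exp (l * Complex.I)) ^ k‖ ^ 2)
      (𝓝[<] 1) (𝓝 (‖transfer (woldCoeff g) l‖ ^ 2)) := by
    refine (Tendsto.norm ?_).pow 2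
    refine tendsto_tsum_of_dominated_convergence (bound := fun k => |woldCoeff g k|) hc
      (fun k => ?_) ?_
    · have h1 : Continuous fun r : ℝ =>
          (woldCoeff g k : ℂ) * ((r : ℂ) * Complex.exp (l * Complex.I)) ^ k := by fun_prop
      have h2 := (h1.tendsto 1).mono_left (nhdsWithin_le_nhds (s := Iio 1))
      convert h2 using 2
      rw [Complex.ofReal_one, one_mul, ← Complex.exp_nat_mul]
      push_cast; ring_nf
    · filter_upwards [hr] with r hr k
      rw [norm_mul, norm_pow, norm_mul, Complex.norm_exp_ofReal_mul_I, Complex.norm_real,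
        Complex.norm_real, Real.norm_of_nonneg hr.1.le, mul_one, Real.norm_eq_abs]
      exact mul_le_of_le_one_right (abs_nonneg _) (pow_le_one₀ hr.1.le hr.2.le)
  have hlim3 := tendsto_nhds_unique (hlim2.congr' (by
    filter_upwards [hr] with r hr
    exact hdisc r hr.1 hr.2)) (Real.continuous_exp.tendsto _ |>.comp (hlim1.const_add _))
  rw [hlim3, innovVar, Real.exp_add, Real.exp_log hl, mul_assoc, ← mul_assoc (Real.exp _),
    ← Real.exp_add, add_neg_cancel, Real.exp_zero, one_mul]

/-! ### Linear combinations of independent innovations -/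

theorem norm_exp_I_sub_taylor_le (x : ℝ) :
    ‖Complex.exp (x * Complex.I) - (1 + x * Complex.I - x ^ 2 / 2)‖ ≤ 4 * |x| ^ 3 := by
  have hn : ‖(x : ℂ) * Complex.I‖ = |x| := by simp
  rcases le_total |x| 1 with hx | hx
  · have h := Complex.exp_bound (x := x * Complex.I) (hn.trans_le hx) (n := 3) (by norm_num)
    rw [hn] at h
    have e : ∑ m ∈ Finset.range 3, ((x : ℂ) * Complex.I) ^ m / (m.factorial : ℂ) =
        1 + x * Complex.I - x ^ 2 / 2 := by
      simp [Finset.sum_range_succ, mul_pow]; ring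
    rw [e] at h
    refine h.trans ?_
    have : 0 ≤ |x| ^ 3 := by positivity
    norm_num [Nat.factorial]
    linarith
  · calc _ ≤ ‖Complex.exp (x * Complex.I)‖ + (‖(1 : ℂ)‖ + ‖x * Complex.I‖ + ‖(x : ℂ) ^ 2 / 2‖) :=
          (norm_sub_le _ _).trans (add_le_add le_rfl
            ((norm_sub_le _ _).trans (add_le_add (norm_add_le _ _) le_rfl)))
      _ = 1 + (1 + |x| + |x| ^ 2 / 2) := by
          rw [Complex.norm_exp_ofReal_mul_I, hn]; simp
      _ ≤ 4 * |x| ^ 3 := by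
          have h2 : |x| ≤ |x| ^ 3 := le_self_pow₀ hx (by norm_num)
          have h3 : |x| ^ 2 ≤ |x| ^ 3 := pow_le_pow_right₀ hx (by norm_num)
          linarith

theorem abs_exp_neg_sub_le {y : ℝ} (hy : 0 ≤ y) : |Real.exp (-y) - (1 - y)| ≤ y ^ 2 := by
  rcases le_total y 1 with h | h
  · have := Real.abs_exp_sub_one_sub_id_le (x := -y) (by rwa [abs_neg, abs_of_nonneg hy])
    rw [neg_sq] at this
    convert this using 2; ring
  · have h1 := Real.add_one_le_exp (-y)
    have h2 := Real.exp_le_one_iff.2 (neg_nonpos.2 hy)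
    rw [abs_of_nonneg (by linarith)]
    nlinarith

/-- The factors are exchanged one at a time; all the others have modulus at most one. -/
theorem norm_prod_sub_prod_le {ι : Type*} (S : Finset ι) (a b : ι → ℂ) (ha : ∀ i ∈ S, ‖a i‖ ≤ 1)
    (hb : ∀ i ∈ S, ‖b i‖ ≤ 1) : ‖∏ i ∈ S, a i - ∏ i ∈ S, b i‖ ≤ ∑ i ∈ S, ‖a i - b i‖ := by
  classical
  induction S using Finset.induction_on with
  | empty => simp
  | insert i S hi ih =>
    rw [Finset.prod_insert hi, Finset.prod_insert hi, Finset.sum_insert hi]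
    have h1 : ‖∏ j ∈ S, a j‖ ≤ 1 := by
      rw [norm_prod]
      exact Finset.prod_le_one (fun _ _ => norm_nonneg _)
        fun j hj => ha j (Finset.mem_insert_of_mem hj)
    have h2 := ih (fun j hj => ha j (Finset.mem_insert_of_mem hj))
      (fun j hj => hb j (Finset.mem_insert_of_mem hj))
    have h3 := hb i (Finset.mem_insert_self i S)
    calc ‖a i * ∏ j ∈ S, a j - b i * ∏ j ∈ S, b j‖
        = ‖(a i - b i) * ∏ j ∈ S, a j + b i * (∏ j ∈ S, a j - ∏ j ∈ S, b j)‖ := by ring_nf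
      _ ≤ ‖a i - b i‖ * ‖∏ j ∈ S, a j‖ + ‖b i‖ * ‖∏ j ∈ S, a j - ∏ j ∈ S, b j‖ := by
          rw [← norm_mul, ← norm_mul]; exact norm_add_le _ _
      _ ≤ ‖a i - b i‖ * 1 + 1 * ∑ j ∈ S, ‖a j - b j‖ := by gcongr
      _ = _ := by ring

instance isProbabilityMeasure_innovLaw (q : Measure ℝ) [IsProbabilityMeasure q] :
    IsProbabilityMeasure (innovLaw q) := by
  unfold innovLaw; infer_instance

theorem measurePreserving_eval_innovLaw (q : Measure ℝ) [IsProbabilityMeasure q] (i : ℤ) :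
    MeasurePreserving (fun e : ℤ → ℝ => e i) (innovLaw q) q :=
  measurePreserving_eval_infinitePi (fun _ : ℤ => q) i

theorem integral_innovLaw_eval (q : Measure ℝ) [IsProbabilityMeasure q] (i : ℤ) {f : ℝ → ℝ}
    (hf : StronglyMeasurable f) : ∫ e, f (e i) ∂(innovLaw q) = ∫ z, f z ∂q := by
  conv_rhs => rw [← (measurePreserving_eval_innovLaw q i).map_eq]
  rw [integral_map (measurable_pi_apply i).aemeasurable hf.aestronglyMeasurable]

/-- Innovation laws: centred, with variance `s` and fourth moment at most `K`. -/
structure IsInnovation (q : Measure ℝ) (s K : ℝ) : Prop where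
  mean : ∫ z, z ∂q = 0
  var : ∫ z, z ^ 2 ∂q = s
  fourth : ∫⁻ z, ENNReal.ofReal (z ^ 4) ∂q ≤ ENNReal.ofReal K

namespace IsInnovation

variable {q : Measure ℝ} {s K : ℝ}

theorem integrable_pow_four (h : IsInnovation q s K) : Integrable (fun z : ℝ => z ^ 4) q := by
  refine ⟨by fun_prop, ?_⟩
  rw [hasFiniteIntegral_iff_ofReal (Eventually.of_forall fun z => by positivity)]
  exact h.fourth.trans_lt ENNReal.ofReal_lt_top

theorem integral_pow_four_le (h : IsInnovation q s K) (hK : 0 ≤ K) : ∫ z, z ^ 4 ∂q ≤ K := by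
  rw [integral_eq_lintegral_of_nonneg_ae (Eventually.of_forall fun z => by positivity)
    (by fun_prop)]
  exact ENNReal.toReal_le_of_le_ofReal hK h.fourth

theorem var_nonneg (h : IsInnovation q s K) : 0 ≤ s := by
  rw [← h.var]; exact integral_nonneg fun z => sq_nonneg z

variable [IsProbabilityMeasure q]

/-- The majorant `1 + z ^ 4` controls all lower moments at once, so that the later constants depend
on the innovation law through `K` only. -/
theorem integrable_of_le {f : ℝ → ℝ} (h : IsInnovation q s K) (hf : Continuous f)
    (hle : ∀ z, |f z| ≤ 1 + z ^ 4) : Integrable f q :=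
  ((integrable_const 1).add h.integrable_pow_four).mono' hf.aestronglyMeasurable
    (Eventually.of_forall hle)

theorem integral_le {f : ℝ → ℝ} (h : IsInnovation q s K) (hK : 0 ≤ K) (hf : Continuous f)
    (hle : ∀ z, |f z| ≤ 1 + z ^ 4) : ∫ z, f z ∂q ≤ 1 + K := by
  calc ∫ z, f z ∂q ≤ ∫ z, (1 + z ^ 4) ∂q := integral_mono (h.integrable_of_le hf hle)
        ((integrable_const 1).add h.integrable_pow_four) fun z => (le_abs_self _).trans (hle z)
    _ = 1 + ∫ z, z ^ 4 ∂q := by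
        rw [integral_add (integrable_const 1) h.integrable_pow_four]; simp
    _ ≤ 1 + K := by gcongr; exact h.integral_pow_four_le hK

theorem abs_le_aux (z : ℝ) : |z| ≤ 1 + z ^ 4 := by
  rw [abs_le]
  constructor <;> nlinarith [sq_nonneg (z ^ 2 - 1), sq_nonneg (z - 1), sq_nonneg (z + 1)]

theorem sq_le_aux (z : ℝ) : |z ^ 2| ≤ 1 + z ^ 4 := by
  rw [abs_of_nonneg (sq_nonneg z)]; nlinarith [sq_nonneg (z ^ 2 - 1)]

theorem cube_le_aux (z : ℝ) : |(|z| ^ 3)| ≤ 1 + z ^ 4 := by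
  have h0 := abs_nonneg z
  have h4 : z ^ 4 = |z| ^ 4 := by rw [← abs_pow, abs_of_nonneg (by positivity : 0 ≤ z ^ 4)]
  rw [abs_of_nonneg (by positivity), h4]
  rcases le_total |z| 1 with h | h
  · have : |z| ^ 3 ≤ 1 := pow_le_one₀ h0 h
    have : 0 ≤ |z| ^ 4 := by positivity
    linarith
  · have : |z| ^ 3 ≤ |z| ^ 4 := pow_le_pow_right₀ h (by norm_num)
    linarith

theorem integrable_id (h : IsInnovation q s K) : Integrable (fun z : ℝ => z) q :=
  h.integrable_of_le continuous_id abs_le_aux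

theorem integrable_sq (h : IsInnovation q s K) : Integrable (fun z : ℝ => z ^ 2) q :=
  h.integrable_of_le (by fun_prop) sq_le_aux

theorem integrable_abs_cube (h : IsInnovation q s K) : Integrable (fun z : ℝ => |z| ^ 3) q :=
  h.integrable_of_le (by fun_prop) cube_le_aux

theorem var_le (h : IsInnovation q s K) (hK : 0 ≤ K) : s ≤ 1 + K := by
  rw [← h.var]; exact h.integral_le hK (by fun_prop) sq_le_aux

/-- Second-order Taylor expansion under the integral: the mean is zero, the variance is `s`, and the
remainder is bounded by the third absolute moment. -/
theorem norm_charFun_sub_le (h : IsInnovation q s K) (hK : 0 ≤ K) (u : ℝ) :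
    ‖charFun q u - ((1 - s * u ^ 2 / 2 : ℝ) : ℂ)‖ ≤ 4 * (1 + K) * |u| ^ 3 := by
  have i1 : Integrable (fun z : ℝ => ((u * z : ℝ) : ℂ) * Complex.I) q :=
    ((h.integrable_id.const_mul u).ofReal (𝕜 := ℂ)).mul_const _
  have i2 : Integrable (fun z : ℝ => ((u * z : ℝ) : ℂ) ^ 2 / 2) q := by
    have := ((h.integrable_sq.const_mul (u ^ 2 / 2)).ofReal (𝕜 := ℂ))
    refine this.congr (Eventually.of_forall fun z => ?_)
    simp only [Complex.coe_algebraMap]; push_cast; ring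
  have i0 : Integrable (fun z : ℝ => Complex.exp (((u * z : ℝ) : ℂ) * Complex.I)) q := by
    refine (integrable_const (1 : ℝ)).mono' (by fun_prop) (Eventually.of_forall fun z => ?_)
    rw [Complex.norm_exp_ofReal_mul_I]
  have i12 : Integrable (fun z : ℝ => 1 + ((u * z : ℝ) : ℂ) * Complex.I - ((u * z : ℝ) : ℂ) ^ 2 / 2)
      q := ((integrable_const _).add i1).sub i2
  have e : ∫ z, (1 + ((u * z : ℝ) : ℂ) * Complex.I - ((u * z : ℝ) : ℂ) ^ 2 / 2) ∂q =
      ((1 - s * u ^ 2 / 2 : ℝ) : ℂ) := by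
    rw [integral_sub (f := fun z : ℝ => 1 + ((u * z : ℝ) : ℂ) * Complex.I)
      ((integrable_const _).add i1) i2, integral_add (integrable_const _) i1,
      integral_mul_const, integral_complex_ofReal, integral_const_mul, h.mean]
    have : ∫ z : ℝ, ((u * z : ℝ) : ℂ) ^ 2 / 2 ∂q = ((u ^ 2 / 2 * s : ℝ) : ℂ) := by
      rw [← h.var, ← integral_const_mul, ← integral_complex_ofReal]
      refine integral_congr_ae (Eventually.of_forall fun z => ?_)
      simp only; push_cast; ring
    rw [this]
    simp
    ring
  have hchar : charFun q u = ∫ z : ℝ, Complex.exp (((u * z : ℝ) : ℂ) * Complex.I) ∂q := by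
    rw [charFun_apply_real]; push_cast; rfl
  rw [← e, hchar, ← integral_sub i0 i12]
  calc _ ≤ ∫ z, 4 * |u| ^ 3 * |z| ^ 3 ∂q := by
        refine norm_integral_le_of_norm_le (h.integrable_abs_cube.const_mul _)
          (Eventually.of_forall fun z => ?_)
        refine (norm_exp_I_sub_taylor_le (u * z)).trans_eq ?_
        rw [abs_mul]; ring
    _ = 4 * |u| ^ 3 * ∫ z, |z| ^ 3 ∂q := integral_const_mul _ _
    _ ≤ 4 * |u| ^ 3 * (1 + K) := by
        gcongr; exact h.integral_le hK (by fun_prop) cube_le_aux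
    _ = _ := by ring

theorem charFun_linearCombination (S : Finset ℤ) (w : ℤ → ℝ) (t : ℝ) :
    charFun ((innovLaw q).map fun e => ∑ i ∈ S, w i * e i) t = ∏ i ∈ S, charFun q (w i * t) := by
  have hind : iIndepFun (fun (i : ℤ) (e : ℤ → ℝ) => w i * e i) (innovLaw q) :=
    iIndepFun_infinitePi (P := fun _ : ℤ => q) (X := fun i z => w i * z) fun i => by fun_prop
  rw [iIndepFun.charFun_map_fun_finsetSum_eq_prod (X := fun (i : ℤ) (e : ℤ → ℝ) => w i * e i)
    (fun i _ => (by fun_prop : Measurable fun e : ℤ → ℝ => w i * e i).aemeasurable)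
    (hind.restrict S), Finset.prod_apply]
  refine Finset.prod_congr rfl fun i _ => ?_
  have hmp := measurePreserving_eval_innovLaw q i
  rw [← charFun_map_mul]
  conv_rhs => rw [← hmp.map_eq, Measure.map_map (by fun_prop) (by fun_prop)]
  rfl

/-- A Lyapunov bound. Each factor is compared with its Gaussian counterpart through `1 - s u² / 2`,
at a cost of third and fourth order in `w i`. Two powers of `w i` sum to at most `W`, and the
remaining ones are bounded by `β`, the source of smallness. -/
theorem norm_charFun_linearCombination_sub_le (h : IsInnovation q s K) (hK : 0 ≤ K)
    (S : Finset ℤ) (w : ℤ → ℝ) {β W : ℝ} (hβ : ∀ i ∈ S, |w i| ≤ β) (hW : ∑ i ∈ S, w i ^ 2 ≤ W)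
    (hβ0 : 0 ≤ β) (t : ℝ) :
    ‖charFun ((innovLaw q).map fun e => ∑ i ∈ S, w i * e i) t -
        (Real.exp (-(s * (∑ i ∈ S, w i ^ 2) * t ^ 2 / 2)) : ℝ)‖ ≤
      β * W * (4 * (1 + K) * |t| ^ 3 + (1 + K) ^ 2 * t ^ 4 * β) := by
  have hs := h.var_nonneg
  have hprod : ((Real.exp (-(s * (∑ i ∈ S, w i ^ 2) * t ^ 2 / 2)) : ℝ) : ℂ) =
      ∏ i ∈ S, ((Real.exp (-(s * (w i * t) ^ 2 / 2)) : ℝ) : ℂ) := by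
    rw [← Complex.ofReal_prod, ← Real.exp_sum, Finset.sum_neg_distrib, ← Finset.sum_div,
      ← Finset.mul_sum, mul_assoc s, Finset.sum_mul]
    simp_rw [mul_pow]
  rw [charFun_linearCombination, hprod]
  refine (norm_prod_sub_prod_le S _ _ (fun i _ => norm_charFun_le_one _) fun i _ => ?_).trans ?_
  · rw [Complex.norm_real, Real.norm_of_nonneg (Real.exp_nonneg _), Real.exp_le_one_iff]
    have : 0 ≤ s * (w i * t) ^ 2 / 2 := by positivity
    linarith
  · calc _ ≤ ∑ i ∈ S, w i ^ 2 * (β * (4 * (1 + K) * |t| ^ 3 + (1 + K) ^ 2 * t ^ 4 * β)) := by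
          refine Finset.sum_le_sum fun i hi => ?_
          have h1 := h.norm_charFun_sub_le hK (w i * t)
          have h2 := abs_exp_neg_sub_le (y := s * (w i * t) ^ 2 / 2) (by positivity)
          have h3 : ‖charFun q (w i * t) - ((Real.exp (-(s * (w i * t) ^ 2 / 2)) : ℝ) : ℂ)‖ ≤
              4 * (1 + K) * |w i * t| ^ 3 + (s * (w i * t) ^ 2 / 2) ^ 2 := by
            refine (norm_sub_le_norm_sub_add_norm_sub _
              ((1 - s * (w i * t) ^ 2 / 2 : ℝ) : ℂ) _).trans (add_le_add h1 ?_)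
            rw [← Complex.ofReal_sub, Complex.norm_real, Real.norm_eq_abs, abs_sub_comm]
            exact h2
          refine h3.trans ?_
          have hw := hβ i hi
          have hwsq : |w i| ^ 2 = w i ^ 2 := sq_abs _
          have h4 : |w i * t| ^ 3 ≤ w i ^ 2 * (β * |t| ^ 3) := by
            rw [abs_mul, mul_pow, ← hwsq]
            have : |w i| ^ 3 ≤ |w i| ^ 2 * β := by
              rw [pow_succ]; gcongr
            calc |w i| ^ 3 * |t| ^ 3 ≤ (|w i| ^ 2 * β) * |t| ^ 3 := by gcongr
              _ = _ := by ring
          have h5 : (s * (w i * t) ^ 2 / 2) ^ 2 ≤ w i ^ 2 * (β * ((1 + K) ^ 2 * t ^ 4 * β)) := by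
            have h6 : w i ^ 2 ≤ β ^ 2 := by rw [← hwsq]; gcongr
            have h7 : s ^ 2 ≤ (1 + K) ^ 2 := by
              have := h.var_le hK
              gcongr
            calc (s * (w i * t) ^ 2 / 2) ^ 2 = s ^ 2 * (w i ^ 2 * w i ^ 2) * t ^ 4 / 4 := by ring
              _ ≤ s ^ 2 * (w i ^ 2 * w i ^ 2) * t ^ 4 := by
                  have : 0 ≤ s ^ 2 * (w i ^ 2 * w i ^ 2) * t ^ 4 := by positivity
                  linarith
              _ ≤ (1 + K) ^ 2 * (w i ^ 2 * β ^ 2) * t ^ 4 := by gcongr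
              _ = _ := by ring
          calc _ ≤ 4 * (1 + K) * (w i ^ 2 * (β * |t| ^ 3)) +
                w i ^ 2 * (β * ((1 + K) ^ 2 * t ^ 4 * β)) := by gcongr
            _ = _ := by ring
      _ = (∑ i ∈ S, w i ^ 2) * (β * (4 * (1 + K) * |t| ^ 3 + (1 + K) ^ 2 * t ^ 4 * β)) := by
          rw [Finset.sum_mul]
      _ ≤ W * (β * (4 * (1 + K) * |t| ^ 3 + (1 + K) ^ 2 * t ^ 4 * β)) := by gcongr
      _ = _ := by ring

theorem integrable_eval_mul_eval (h : IsInnovation q s K) (i j : ℤ) :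
    Integrable (fun e : ℤ → ℝ => e i * e j) (innovLaw q) ∧
      ∫ e : ℤ → ℝ, e i * e j ∂(innovLaw q) = if i = j then s else 0 := by
  have hmp := measurePreserving_eval_innovLaw q
  have hm : ∀ i : ℤ, AEStronglyMeasurable (fun e : ℤ → ℝ => e i) (innovLaw q) := fun i =>
    (measurable_pi_apply i).aestronglyMeasurable
  have hint : ∀ i : ℤ, Integrable (fun e : ℤ → ℝ => e i) (innovLaw q) := fun i =>
    (hmp i).integrable_comp_of_integrable h.integrable_id
  have hzero : ∀ i : ℤ, ∫ e : ℤ → ℝ, e i ∂(innovLaw q) = 0 := fun i => by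
    rw [← h.mean, ← integral_innovLaw_eval q i (by fun_prop)]
  split_ifs with hij
  · subst hij
    constructor
    · have := (hmp i).integrable_comp_of_integrable h.integrable_sq
      refine this.congr (Eventually.of_forall fun e => ?_)
      simp [sq]
    · rw [← h.var, ← integral_innovLaw_eval q i (by fun_prop)]
      simp only [sq]
  · have hind : iIndepFun (fun (i : ℤ) (e : ℤ → ℝ) => e i) (innovLaw q) :=
      iIndepFun_infinitePi (P := fun _ : ℤ => q) (X := fun i z => z) fun i => by fun_prop
    have h2 := hind.indepFun hij
    exact ⟨h2.integrable_mul (hint i) (hint j), by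
      rw [h2.integral_fun_mul_eq_mul_integral (hm i) (hm j), hzero, zero_mul]⟩

end IsInnovation

/-! ### The mean of a linear process -/

theorem IsInnovation.lintegral_linearCombination_sq {q : Measure ℝ} {s K : ℝ}
    [IsProbabilityMeasure q] (h : IsInnovation q s K) (S : Finset ℤ) (w : ℤ → ℝ) :
    ∫⁻ e : ℤ → ℝ, ENNReal.ofReal ((∑ i ∈ S, w i * e i) ^ 2) ∂(innovLaw q) =
      ENNReal.ofReal (s * ∑ i ∈ S, w i ^ 2) := by
  have hexp : ∀ e : ℤ → ℝ, (∑ i ∈ S, w i * e i) ^ 2 =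
      ∑ i ∈ S, ∑ j ∈ S, w i * w j * (e i * e j) := fun e => by
    rw [sq, Finset.sum_mul_sum]
    exact Finset.sum_congr rfl fun i _ => Finset.sum_congr rfl fun j _ => by ring
  have hint : ∀ i j : ℤ, Integrable (fun e : ℤ → ℝ => w i * w j * (e i * e j)) (innovLaw q) :=
    fun i j => (h.integrable_eval_mul_eval i j).1.const_mul _
  have hint2 : Integrable (fun e : ℤ → ℝ => (∑ i ∈ S, w i * e i) ^ 2) (innovLaw q) := by
    simp_rw [hexp]
    exact integrable_finsetSum _ fun i _ => integrable_finsetSum _ fun j _ => hint i j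
  rw [← ofReal_integral_eq_lintegral_ofReal hint2 (Eventually.of_forall fun e => sq_nonneg _)]
  congr 1
  simp_rw [hexp]
  rw [integral_finsetSum _ fun i _ => integrable_finsetSum _ fun j _ => hint i j, Finset.mul_sum]
  refine Finset.sum_congr rfl fun i hi => ?_
  rw [integral_finsetSum _ fun j _ => hint i j]
  simp_rw [integral_const_mul, (h.integrable_eval_mul_eval i _).2]
  simp [hi]; ring

/-- The weight of the innovation with index `i` in the mean of a moving average of order `J`. -/
noncomputable def meanWeight (c : ℕ → ℝ) (n J : ℕ) (i : ℤ) : ℝ :=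
  (√n)⁻¹ * ∑ t ∈ Finset.range n, ∑ j ∈ Finset.range J, if (t : ℤ) + 1 - j = i then c j else 0

/-- The module is general because `φ` is taken both as the innovation sequence, giving the mean
itself, and as `i ↦ exp(iil)`, giving the Fourier transform of the weights. -/
theorem sum_meanWeight_smul {A : Type*} [AddCommGroup A] [Module ℝ A] (c : ℕ → ℝ) (n J : ℕ)
    (φ : ℤ → A) : ∑ i ∈ Finset.Icc (-(J : ℤ)) n, meanWeight c n J i • φ i =
      (√n)⁻¹ • ∑ t ∈ Finset.range n, ∑ j ∈ Finset.range J, c j • φ ((t : ℤ) + 1 - j) := by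
  simp_rw [meanWeight, mul_smul]
  rw [← Finset.smul_sum]
  congr 1
  simp_rw [Finset.sum_smul]
  rw [Finset.sum_comm]
  refine Finset.sum_congr rfl fun t ht => ?_
  rw [Finset.sum_comm]
  refine Finset.sum_congr rfl fun j hj => ?_
  rw [Finset.sum_eq_single_of_mem ((t : ℤ) + 1 - j)]
  · simp
  · rw [Finset.mem_range] at ht hj
    rw [Finset.mem_Icc]; omega
  · intro i _ hi
    rw [if_neg (fun h => hi h.symm), zero_smul]

theorem sum_range_abs_le {c : ℕ → ℝ} {C : ℝ} (hc : Summable fun k => |c k|)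
    (hC : ∑' k, |c k| ≤ C) (J : ℕ) : ∑ j ∈ Finset.range J, |c j| ≤ C :=
  (hc.sum_le_tsum _ fun _ _ => abs_nonneg _).trans hC

/-- For given `i` and `j` at most one time `t` contributes, so after interchanging the sums each `|c
j|` is counted at most once. -/
theorem abs_meanWeight_le {c : ℕ → ℝ} {C : ℝ} (hc : Summable fun k => |c k|)
    (hC : ∑' k, |c k| ≤ C) (n J : ℕ) (i : ℤ) : |meanWeight c n J i| ≤ C / √n := by
  rw [meanWeight, abs_mul, abs_of_nonneg (by positivity : 0 ≤ (√(n : ℝ))⁻¹), div_eq_inv_mul]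
  gcongr
  refine (Finset.abs_sum_le_sum_abs _ _).trans (le_trans (Finset.sum_le_sum fun t _ =>
    Finset.abs_sum_le_sum_abs _ _) (le_trans ?_ (sum_range_abs_le hc hC J)))
  rw [Finset.sum_comm]
  refine Finset.sum_le_sum fun j _ => ?_
  by_cases h : ∃ t ∈ Finset.range n, (t : ℤ) + 1 - j = i
  · obtain ⟨t, ht, rfl⟩ := h
    rw [Finset.sum_eq_single_of_mem t ht]
    · simp
    · intro u _ hu
      rw [if_neg (by omega), abs_zero]
  · push Not at h
    rw [Finset.sum_eq_zero fun t ht => by rw [if_neg (h t ht), abs_zero]]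
    exact abs_nonneg _

/-- By Parseval the left side integrates the squared Fourier transform of the weights. Up to a phase
and `1/√n`, that transform is the product of `∑ exp(itl)` and the conjugate of the truncated
transfer function; the conjugate comes from the lag `-j`. -/
theorem two_pi_mul_sum_meanWeight_sq (c : ℕ → ℝ) (n J : ℕ) :
    2 * Real.pi * ∑ i ∈ Finset.Icc (-(J : ℤ)) n, meanWeight c n J i ^ 2 =
      ∫ l in (-Real.pi)..Real.pi,
        ‖∑ j ∈ Finset.range J, (c j : ℂ) * Complex.exp ((j * l : ℝ) * Complex.I)‖ ^ 2 *
          fejer n l := by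
  rw [← integral_norm_sum_exp_sq]
  refine intervalIntegral.integral_congr fun l _ => ?_
  have h := sum_meanWeight_smul c n J (fun i : ℤ => Complex.exp ((i * l : ℝ) * Complex.I))
  simp only [Complex.real_smul] at h
  rw [h]
  have hfac : ∑ t ∈ Finset.range n, ∑ j ∈ Finset.range J, (c j : ℂ) *
      Complex.exp ((((t : ℤ) + 1 - j : ℤ) * l : ℝ) * Complex.I) =
      Complex.exp (l * Complex.I) *
        ((∑ t ∈ Finset.range n, Complex.exp ((t * l : ℝ) * Complex.I)) *
        (starRingEnd ℂ) (∑ j ∈ Finset.range J, (c j : ℂ) *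
          Complex.exp ((j * l : ℝ) * Complex.I))) := by
    rw [map_sum, Finset.sum_mul_sum, Finset.mul_sum]
    refine Finset.sum_congr rfl fun t _ => ?_
    rw [Finset.mul_sum]
    refine Finset.sum_congr rfl fun j _ => ?_
    rw [map_mul, Complex.conj_ofReal, ← Complex.exp_conj, map_mul, Complex.conj_I,
      Complex.conj_ofReal, mul_left_comm _ (c j : ℂ), mul_left_comm _ (c j : ℂ), ← Complex.exp_add,
      ← Complex.exp_add]
    congr 2
    push_cast; ring
  rw [hfac, norm_mul, norm_mul, norm_mul, RCLike.norm_conj, Complex.norm_exp_ofReal_mul_I,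
    Complex.norm_real, fejer, norm_inv, Real.norm_of_nonneg (Real.sqrt_nonneg _), mul_pow,
    inv_pow, Real.sq_sqrt (Nat.cast_nonneg n)]
  ring

theorem norm_partial_transfer_le {c : ℕ → ℝ} {C : ℝ} (hc : Summable fun k => |c k|)
    (hC : ∑' k, |c k| ≤ C) (J : ℕ) (l : ℝ) :
    ‖∑ j ∈ Finset.range J, (c j : ℂ) * Complex.exp ((j * l : ℝ) * Complex.I)‖ ≤ C := by
  refine (norm_sum_le _ _).trans (le_trans (le_of_eq ?_) (sum_range_abs_le hc hC J))
  refine Finset.sum_congr rfl fun j _ => ?_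
  rw [norm_mul, Complex.norm_exp_ofReal_mul_I, Complex.norm_real, mul_one, Real.norm_eq_abs]

theorem sum_meanWeight_sq_le {c : ℕ → ℝ} {C : ℝ} (hc : Summable fun k => |c k|)
    (hC : ∑' k, |c k| ≤ C) {n : ℕ} (hn : 1 ≤ n) (J : ℕ) :
    ∑ i ∈ Finset.Icc (-(J : ℤ)) n, meanWeight c n J i ^ 2 ≤ C ^ 2 := by
  have hpi := Real.pi_pos
  have h : 2 * Real.pi * ∑ i ∈ Finset.Icc (-(J : ℤ)) n, meanWeight c n J i ^ 2 ≤
      2 * Real.pi * C ^ 2 := by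
    rw [two_pi_mul_sum_meanWeight_sq]
    have hf := continuous_fejer n
    calc _ ≤ ∫ l in (-Real.pi)..Real.pi, C ^ 2 * fejer n l := by
          refine intervalIntegral.integral_mono_on (by linarith)
            (by apply Continuous.intervalIntegrable; fun_prop)
            (by apply Continuous.intervalIntegrable; fun_prop) fun l _ => ?_
          have := norm_partial_transfer_le hc hC J l
          have := fejer_nonneg n l
          gcongr
      _ = 2 * Real.pi * C ^ 2 := by
          rw [intervalIntegral.integral_const_mul, integral_fejer hn]; ring
  exact le_of_mul_le_mul_left h (by positivity)

theorem tendsto_sum_meanWeight_sq {c : ℕ → ℝ} (hc : Summable fun k => |c k|) (n : ℕ) :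
    Tendsto (fun J : ℕ => ∑ i ∈ Finset.Icc (-(J : ℤ)) n, meanWeight c n J i ^ 2) atTop
      (𝓝 ((2 * Real.pi)⁻¹ *
        ∫ l in (-Real.pi)..Real.pi, ‖transfer c l‖ ^ 2 * fejer n l)) := by
  have hf := continuous_fejer n
  have e : ∀ J : ℕ, ∑ i ∈ Finset.Icc (-(J : ℤ)) n, meanWeight c n J i ^ 2 = (2 * Real.pi)⁻¹ *
      ∫ l in (-Real.pi)..Real.pi,
        ‖∑ j ∈ Finset.range J, (c j : ℂ) * Complex.exp ((j * l : ℝ) * Complex.I)‖ ^ 2 *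
          fejer n l := fun J => by
    rw [← two_pi_mul_sum_meanWeight_sq]
    have := Real.pi_ne_zero
    field_simp
  simp_rw [e]
  refine Tendsto.const_mul _ ?_
  refine intervalIntegral.tendsto_integral_filter_of_dominated_convergence
    (fun l => (∑' k, |c k|) ^ 2 * fejer n l) (Eventually.of_forall fun J => ?_)
    (Eventually.of_forall fun J => Eventually.of_forall fun l _ => ?_)
    (by apply Continuous.intervalIntegrable; fun_prop) (Eventually.of_forall fun l _ => ?_)
  · exact Continuous.aestronglyMeasurable (by fun_prop)
  · have h1 := fejer_nonneg n l
    rw [Real.norm_of_nonneg (by positivity)]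
    have := norm_partial_transfer_le hc le_rfl J l
    gcongr
  · have hs : Summable fun k : ℕ => (c k : ℂ) * Complex.exp ((k * l : ℝ) * Complex.I) := by
      refine Summable.of_norm_bounded hc fun k => ?_
      rw [norm_mul, Complex.norm_exp_ofReal_mul_I, Complex.norm_real, mul_one, Real.norm_eq_abs]
    exact ((hs.hasSum.tendsto_sum_nat.norm).pow 2).mul_const _

/-- `∑ |c_j| E|ε|` is finite. Since a divergent `tsum` is `0` by convention, this is what makes the
pseudo observations genuine limits of moving averages. -/
theorem IsInnovation.ae_summable {q : Measure ℝ} {s K : ℝ} [IsProbabilityMeasure q]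
    (h : IsInnovation q s K) {c : ℕ → ℝ} (hc : Summable fun k => |c k|) :
    ∀ᵐ e ∂(innovLaw q), ∀ t : ℤ, Summable fun j : ℕ => c j * e (t - j) := by
  rw [ae_all_iff]
  intro t
  have hm : ∀ j : ℕ, Measurable fun e : ℤ → ℝ => ‖c j * e (t - j)‖ₑ := fun j => by fun_prop
  have hfin : ∫⁻ e : ℤ → ℝ, ∑' j : ℕ, ‖c j * e (t - j)‖ₑ ∂(innovLaw q) ≠ ⊤ := by
    rw [lintegral_tsum fun j => (hm j).aemeasurable]
    have e1 : ∀ j : ℕ, ∫⁻ e : ℤ → ℝ, ‖c j * e (t - j)‖ₑ ∂(innovLaw q) =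
        ENNReal.ofReal |c j| * ∫⁻ z, ‖z‖ₑ ∂q := fun j => by
      simp_rw [enorm_mul]
      rw [lintegral_const_mul _ (by fun_prop)]
      rw [(measurePreserving_eval_innovLaw q (t - j)).lintegral_comp (f := fun z => ‖z‖ₑ)
        (by fun_prop), Real.enorm_eq_ofReal_abs]
    simp_rw [e1]
    rw [ENNReal.tsum_mul_right, ← ENNReal.ofReal_tsum_of_nonneg (fun _ => abs_nonneg _) hc]
    exact ENNReal.mul_ne_top ENNReal.ofReal_ne_top h.integrable_id.2.ne
  have := ae_lt_top (Measurable.tsum hm) hfin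
  filter_upwards [this] with e he
  have : Summable fun j : ℕ => ‖c j * e (t - j)‖₊ :=
    ENNReal.tsum_coe_ne_top_iff_summable.1 he.ne
  exact (NNReal.summable_coe.2 this).of_norm

theorem IsInnovation.aemeasurable_pseudoSample {q : Measure ℝ} {s K : ℝ} [IsProbabilityMeasure q]
    (h : IsInnovation q s K) {c : ℕ → ℝ} (hc : Summable fun k => |c k|) (m : ℝ) (n : ℕ) :
    AEMeasurable (pseudoSample c m n) (innovLaw q) := by
  rw [aemeasurable_pi_iff]
  intro i
  refine AEMeasurable.add_const ?_ m
  refine aemeasurable_of_tendsto_metrizable_ae atTop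
    (f := fun (J : ℕ) (e : ℤ → ℝ) => ∑ j ∈ Finset.range J, c j * e ((i : ℤ) + 1 - j))
    (fun J => Measurable.aemeasurable (by fun_prop)) ?_
  filter_upwards [h.ae_summable hc] with e he
  exact (he _).hasSum.tendsto_sum_nat

/-- The centred and scaled mean `√n (x̄ - m)`. -/
noncomputable def scaledMean {n : ℕ} (x : Fin n → ℝ) (m : ℝ) : ℝ := √n * (sampleMean x - m)

theorem measurable_sampleMean (n : ℕ) : Measurable (sampleMean : (Fin n → ℝ) → ℝ) := by
  unfold sampleMean; fun_prop

theorem IsInnovation.ae_tendsto_scaledMean {q : Measure ℝ} {s K : ℝ} [IsProbabilityMeasure q]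
    (h : IsInnovation q s K) {c : ℕ → ℝ} (hc : Summable fun k => |c k|) (m : ℝ) {n : ℕ}
    (hn : 1 ≤ n) :
    ∀ᵐ e ∂(innovLaw q), Tendsto
      (fun J : ℕ => ∑ i ∈ Finset.Icc (-(J : ℤ)) n, meanWeight c n J i * e i) atTop
      (𝓝 (scaledMean (pseudoSample c m n e) m)) := by
  filter_upwards [h.ae_summable hc] with e he
  have e1 : ∀ J : ℕ, ∑ i ∈ Finset.Icc (-(J : ℤ)) n, meanWeight c n J i * e i =
      (√n)⁻¹ * ∑ t ∈ Finset.range n, ∑ j ∈ Finset.range J, c j * e ((t : ℤ) + 1 - j) := fun J => by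
    simpa using sum_meanWeight_smul c n J e
  have e2 : scaledMean (pseudoSample c m n e) m =
      (√n)⁻¹ * ∑ t ∈ Finset.range n, ∑' j : ℕ, c j * e ((t : ℤ) + 1 - j) := by
    have hn0 : (n : ℝ) ≠ 0 := by positivity
    have hsq : √(n : ℝ) * √n = n := Real.mul_self_sqrt (Nat.cast_nonneg n)
    have hs0 : √(n : ℝ) ≠ 0 := by positivity
    rw [scaledMean, sampleMean, Finset.sum_range]
    simp only [pseudoSample]
    rw [Finset.sum_add_distrib, Finset.sum_const, Finset.card_univ, Fintype.card_fin, nsmul_eq_mul,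
      add_div, mul_div_cancel_left₀ _ hn0, add_sub_cancel_right]
    field_simp
    rw [sq, hsq]
    ring
  simp_rw [e1, e2]
  exact Tendsto.const_mul _ (tendsto_finsetSum _ fun t _ => (he _).hasSum.tendsto_sum_nat)

/-- The variance of the scaled mean of a moving average. -/
noncomputable def meanVar (c : ℕ → ℝ) (s : ℝ) (n : ℕ) : ℝ :=
  s * ((2 * Real.pi)⁻¹ * ∫ l in (-Real.pi)..Real.pi, ‖transfer c l‖ ^ 2 * fejer n l)

/-- Fatou along the truncations `J`; the Mallows argument needs only an upper bound for the second
moment. -/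
theorem IsInnovation.lintegral_scaledMean_sq_le {q : Measure ℝ} {s K : ℝ}
    [IsProbabilityMeasure q] (h : IsInnovation q s K) {c : ℕ → ℝ} (hc : Summable fun k => |c k|)
    (m : ℝ) {n : ℕ} (hn : 1 ≤ n) :
    ∫⁻ e, ENNReal.ofReal (scaledMean (pseudoSample c m n e) m ^ 2) ∂(innovLaw q) ≤
      ENNReal.ofReal (meanVar c s n) := by
  have hlim : ∀ᵐ e ∂(innovLaw q), ENNReal.ofReal (scaledMean (pseudoSample c m n e) m ^ 2) =
      liminf (fun J : ℕ => ENNReal.ofReal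
        ((∑ i ∈ Finset.Icc (-(J : ℤ)) n, meanWeight c n J i * e i) ^ 2)) atTop := by
    filter_upwards [h.ae_tendsto_scaledMean hc m hn] with e he
    exact (ENNReal.tendsto_ofReal (he.pow 2)).liminf_eq.symm
  rw [lintegral_congr_ae hlim]
  refine (lintegral_liminf_le fun J => by fun_prop).trans ?_
  simp_rw [h.lintegral_linearCombination_sq]
  exact ((ENNReal.tendsto_ofReal ((tendsto_sum_meanWeight_sq hc n).const_mul s)).liminf_eq).le

/-- For every truncation the Lyapunov bound holds with `β = C/√n` and `W = C²`, free of `J`, and so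
survives the limit. -/
theorem IsInnovation.norm_charFun_scaledMean_sub_le {q : Measure ℝ} {s K C : ℝ}
    [IsProbabilityMeasure q] (h : IsInnovation q s K) (hK : 0 ≤ K) {c : ℕ → ℝ}
    (hc : Summable fun k => |c k|) (hC : ∑' k, |c k| ≤ C) (m : ℝ) {n : ℕ} (hn : 1 ≤ n) (t : ℝ) :
    ‖charFun ((innovLaw q).map fun e => scaledMean (pseudoSample c m n e) m) t -
        (Real.exp (-(meanVar c s n * t ^ 2 / 2)) : ℝ)‖ ≤
      C / √n * C ^ 2 * (4 * (1 + K) * |t| ^ 3 + (1 + K) ^ 2 * t ^ 4 * (C / √n)) := by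
  have hC0 : 0 ≤ C := (tsum_nonneg fun _ => abs_nonneg _).trans hC
  have hmeas : AEMeasurable (fun e => scaledMean (pseudoSample c m n e) m) (innovLaw q) := by
    have := (measurable_sampleMean n).comp_aemeasurable (h.aemeasurable_pseudoSample hc m n)
    unfold scaledMean
    exact (this.sub_const m).const_mul _
  have hlim1 : Tendsto (fun J : ℕ => charFun ((innovLaw q).map fun e =>
      ∑ i ∈ Finset.Icc (-(J : ℤ)) n, meanWeight c n J i * e i) t) atTop
      (𝓝 (charFun ((innovLaw q).map fun e => scaledMean (pseudoSample c m n e) m) t)) := by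
    have e0 : ∀ Y : (ℤ → ℝ) → ℝ, AEMeasurable Y (innovLaw q) →
        charFun ((innovLaw q).map Y) t =
          ∫ e, Complex.exp (((t * Y e : ℝ) : ℂ) * Complex.I) ∂(innovLaw q) := fun Y hY => by
      rw [charFun_apply_real, integral_map hY (by fun_prop)]
      push_cast; rfl
    rw [e0 _ hmeas]
    simp_rw [fun J : ℕ => e0 (fun e => ∑ i ∈ Finset.Icc (-(J : ℤ)) n, meanWeight c n J i * e i)
      (Measurable.aemeasurable (by fun_prop))]
    refine tendsto_integral_of_dominated_convergence (fun _ => 1)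
      (fun J => Measurable.aestronglyMeasurable (by fun_prop)) (integrable_const _)
      (fun J => Eventually.of_forall fun e => by rw [Complex.norm_exp_ofReal_mul_I]) ?_
    filter_upwards [h.ae_tendsto_scaledMean hc m hn] with e he
    have hcont : Continuous fun y : ℝ => Complex.exp (((t * y : ℝ) : ℂ) * Complex.I) := by fun_prop
    exact (hcont.tendsto _).comp he
  have hlim2 : Tendsto (fun J : ℕ => ((Real.exp (-(s *
      (∑ i ∈ Finset.Icc (-(J : ℤ)) n, meanWeight c n J i ^ 2) * t ^ 2 / 2)) : ℝ) : ℂ)) atTop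
      (𝓝 ((Real.exp (-(meanVar c s n * t ^ 2 / 2)) : ℝ) : ℂ)) := by
    have hcont : Continuous fun y : ℝ => ((Real.exp (-(y * t ^ 2 / 2)) : ℝ) : ℂ) := by fun_prop
    exact (hcont.tendsto _).comp ((tendsto_sum_meanWeight_sq hc n).const_mul s)
  refine le_of_tendsto (hlim1.sub hlim2).norm (Eventually.of_forall fun J => ?_)
  exact h.norm_charFun_linearCombination_sub_le hK _ _ (fun i _ => abs_meanWeight_le hc hC n J i)
    (sum_meanWeight_sq_le hc hC hn J) (by positivity) t

/-! ### Quantile functions and Mallows distance -/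

section Quantile

variable (ν : Measure ℝ) [IsProbabilityMeasure ν]

/-- Right continuity of the distribution function makes the infimum attained; the restriction of `p`
makes the set nonempty and bounded below. -/
theorem quantile_le_iff {p : ℝ} (hp : p ∈ Ioo (0 : ℝ) 1) (x : ℝ) :
    quantile ν p ≤ x ↔ p ≤ (ν (Iic x)).toReal := by
  have hF : ∀ y, (ν (Iic y)).toReal = cdf ν y := fun y => (cdf_eq_real ν y).symm
  simp only [quantile, hF]
  have hne : {x : ℝ | p ≤ cdf ν x}.Nonempty := by
    obtain ⟨y, hy⟩ := ((tendsto_cdf_atTop ν).eventually (lt_mem_nhds hp.2)).exists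
    exact ⟨y, hy.le⟩
  have hbdd : BddBelow {x : ℝ | p ≤ cdf ν x} := by
    obtain ⟨y, hy⟩ := ((tendsto_cdf_atBot ν).eventually (gt_mem_nhds hp.1)).exists
    refine ⟨y, fun x hx => ?_⟩
    by_contra hlt
    exact absurd (hx.trans (monotone_cdf ν (not_le.1 hlt).le)) (not_le.2 hy)
  refine ⟨fun h => ?_, fun h => csInf_le hbdd h⟩
  refine le_trans ?_ (monotone_cdf ν h)
  have hr : Tendsto (cdf ν) (𝓝[>] (sInf {x : ℝ | p ≤ cdf ν x}))
      (𝓝 (cdf ν (sInf {x : ℝ | p ≤ cdf ν x}))) :=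
    ((cdf ν).right_continuous _).tendsto.mono_left (nhdsWithin_mono _ Ioi_subset_Ici_self)
  refine ge_of_tendsto hr ?_
  filter_upwards [self_mem_nhdsWithin] with y hy
  obtain ⟨z, hz, hzy⟩ := (csInf_lt_iff hbdd hne).1 hy
  exact le_trans hz (monotone_cdf ν hzy.le)

theorem monotoneOn_quantile : MonotoneOn (quantile ν) (Ioo 0 1) := fun _ hp _ hq hpq =>
  (quantile_le_iff ν hp _).2 (hpq.trans ((quantile_le_iff ν hq _).1 le_rfl))

theorem aemeasurable_quantile : AEMeasurable (quantile ν) (volume.restrict (Ioo (0 : ℝ) 1)) :=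
  aemeasurable_restrict_of_monotoneOn measurableSet_Ioo (monotoneOn_quantile ν)

theorem map_quantile : (volume.restrict (Ioo (0 : ℝ) 1)).map (quantile ν) = ν := by
  refine Measure.ext_of_Iic _ _ fun x => ?_
  rw [Measure.map_apply_of_aemeasurable (aemeasurable_quantile ν) measurableSet_Iic,
    Measure.restrict_apply' measurableSet_Ioo]
  set a := (ν (Iic x)).toReal with ha
  have ha0 : 0 ≤ a := ENNReal.toReal_nonneg
  have ha1 : a ≤ 1 := ENNReal.toReal_le_of_le_ofReal zero_le_one (by simpa using prob_le_one)
  have e : quantile ν ⁻¹' Iic x ∩ Ioo 0 1 = Iic a ∩ Ioo 0 1 := by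
    ext p
    simp only [mem_inter_iff, mem_preimage, mem_Iic]
    exact and_congr_left fun hp => quantile_le_iff ν hp x
  have hν : ν (Iic x) = ENNReal.ofReal a := (ENNReal.ofReal_toReal (measure_ne_top _ _)).symm
  rw [e, hν]
  refine le_antisymm ?_ ?_
  · calc volume (Iic a ∩ Ioo 0 1) ≤ volume (Ioc 0 a) :=
          by
          refine measure_mono ?_
          rintro p ⟨hpa, hp0, _⟩
          exact ⟨hp0, hpa⟩
      _ = _ := by simp
  · calc ENNReal.ofReal a = volume (Ioo 0 a) := by simp
      _ ≤ _ := by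
          refine measure_mono ?_
          rintro p ⟨hp0, hpa⟩
          exact ⟨hpa.le, hp0, hpa.trans_le ha1⟩

theorem lintegral_quantile_sq : ∫⁻ p in Ioo (0 : ℝ) 1, ENNReal.ofReal (quantile ν p ^ 2) =
    ∫⁻ x, ENNReal.ofReal (x ^ 2) ∂ν := by
  conv_rhs => rw [← map_quantile ν]
  rw [lintegral_map' (by fun_prop) (aemeasurable_quantile ν)]

end Quantile

/-- The squared Mallows distance. -/
noncomputable def mallowsSq (ν ν' : Measure ℝ) : ℝ≥0∞ :=
  ∫⁻ p in Ioo (0 : ℝ) 1, ENNReal.ofReal ((quantile ν p - quantile ν' p) ^ 2)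

theorem mallowsSq_comm (ν ν' : Measure ℝ) : mallowsSq ν ν' = mallowsSq ν' ν := by
  simp only [mallowsSq, sub_sq_comm]

/-- From `(a + b)² ≤ 2a² + 2b²`; the factor `2` is harmless for convergence to zero. -/
theorem mallowsSq_le (ν₁ ν₂ ν₃ : Measure ℝ) [IsProbabilityMeasure ν₁] [IsProbabilityMeasure ν₂] :
    mallowsSq ν₁ ν₃ ≤ 2 * mallowsSq ν₁ ν₂ + 2 * mallowsSq ν₂ ν₃ := by
  have hm : AEMeasurable (fun p => ENNReal.ofReal ((quantile ν₁ p - quantile ν₂ p) ^ 2))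
      (volume.restrict (Ioo (0 : ℝ) 1)) :=
    (((aemeasurable_quantile ν₁).sub (aemeasurable_quantile ν₂)).pow_const 2).ennreal_ofReal
  simp only [mallowsSq]
  rw [← lintegral_const_mul' _ _ (by simp), ← lintegral_const_mul' _ _ (by simp),
    ← lintegral_add_left' (hm.const_mul 2)]
  refine lintegral_mono fun p => ?_
  have h2 : (2 : ℝ≥0∞) = ENNReal.ofReal 2 := by simp
  simp only
  rw [h2, ← ENNReal.ofReal_mul zero_le_two, ← ENNReal.ofReal_mul zero_le_two,
    ← ENNReal.ofReal_add (by positivity) (by positivity)]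
  refine ENNReal.ofReal_le_ofReal ?_
  nlinarith [sq_nonneg ((quantile ν₁ p - quantile ν₂ p) - (quantile ν₂ p - quantile ν₃ p))]

/-- The normal law has no atoms, so distribution functions converge everywhere; its distribution
function is strictly increasing, so each level `p` is crossed at a single point. -/
theorem tendsto_quantile_gaussianReal {ν : ℕ → Measure ℝ} [∀ k, IsProbabilityMeasure (ν k)]
    (hν : ∀ t, Tendsto (fun k => charFun (ν k) t) atTop (𝓝 (charFun (gaussianReal 0 1) t)))
    {p : ℝ} (hp : p ∈ Ioo (0 : ℝ) 1) :
    Tendsto (fun k => quantile (ν k) p) atTop (𝓝 (quantile (gaussianReal 0 1) p)) := by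
  let N : Measure ℝ := gaussianReal 0 1
  have hna : ∀ x : ℝ, N {x} = 0 := fun x => by
    have := nullSingletonClass_gaussianReal (μ := 0) (v := 1) one_ne_zero
    exact measure_singleton x
  have hweak : Tendsto (β := ProbabilityMeasure ℝ) (fun k => ⟨ν k, inferInstance⟩) atTop
      (𝓝 ⟨N, inferInstanceAs (IsProbabilityMeasure (gaussianReal 0 1))⟩) :=
    ProbabilityMeasure.tendsto_of_tendsto_charFun hν
  have hcdf : ∀ x, Tendsto (fun k => (ν k (Iic x)).toReal) atTop (𝓝 (N (Iic x)).toReal) := by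
    intro x
    have h := ProbabilityMeasure.tendsto_measure_of_null_frontier_of_tendsto' hweak (E := Iic x)
      (by rw [frontier_Iic]; exact hna x)
    exact (ENNReal.tendsto_toReal (measure_ne_top N _)).comp h
  have hlt : ∀ x y : ℝ, x < y → (N (Iic x)).toReal < (N (Iic y)).toReal := by
    intro x y hxy
    rw [ENNReal.toReal_lt_toReal (measure_ne_top N _) (measure_ne_top N _)]
    have hpos : 0 < N (Ioc x y) := by
      rw [pos_iff_ne_zero]
      intro h0
      have := gaussianReal_absolutelyContinuous' 0 (v := 1) one_ne_zero h0
      simp at this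
      exact absurd hxy (not_lt.2 this)
    rw [← Iic_union_Ioc_eq_Iic hxy.le, measure_union (by
      rw [Set.disjoint_left]; intro z hz hz'; exact absurd hz (not_le.2 hz'.1)) measurableSet_Ioc]
    exact ENNReal.lt_add_right (measure_ne_top N _) hpos.ne'
  have hle := quantile_le_iff N hp
  rw [tendsto_order]
  refine ⟨fun x hx => ?_, fun x hx => ?_⟩
  · have h1 : (N (Iic x)).toReal < p := not_le.1 fun h => absurd ((hle x).2 h) (not_le.2 hx)
    filter_upwards [(hcdf x).eventually (gt_mem_nhds h1)] with k hk
    exact not_le.1 fun h => absurd ((quantile_le_iff (ν k) hp x).1 h) (not_le.2 hk)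
  · obtain ⟨y, hy, hyx⟩ := exists_between hx
    have h1 : p < (N (Iic y)).toReal := by
      obtain ⟨z, hz, hzy⟩ := exists_between hy
      exact ((hle z).1 hz.le).trans_lt (hlt z y hzy)
    filter_upwards [(hcdf y).eventually (lt_mem_nhds h1)] with k hk
    exact ((quantile_le_iff (ν k) hp y).2 hk.le).trans_lt hyx

theorem integrable_sq_gaussianReal (v : ℝ≥0) :
    Integrable (fun x : ℝ => x ^ 2) (gaussianReal 0 v) := by
  have := (memLp_id_gaussianReal (μ := 0) (v := v) 2).integrable_sq
  simpa using this

theorem integral_sq_gaussianReal (v : ℝ≥0) : ∫ x, x ^ 2 ∂(gaussianReal 0 v) = v := by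
  have h := variance_id_gaussianReal (μ := 0) (v := v)
  rw [variance_eq_integral aemeasurable_id] at h
  simpa using h

theorem tendsto_zero_of_forall_le_ofReal {ι : Type*} {l : Filter ι} {u : ι → ℝ≥0∞}
    (h : ∀ ε : ℝ, 0 < ε → ∀ᶠ k in l, u k ≤ ENNReal.ofReal ε) : Tendsto u l (𝓝 0) := by
  refine ENNReal.tendsto_nhds_zero.2 fun ε hε => ?_
  rcases eq_or_ne ε ⊤ with rfl | hε'
  · exact Eventually.of_forall fun _ => le_top
  · have := h ε.toReal (ENNReal.toReal_pos hε.ne' hε')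
    rwa [ENNReal.ofReal_toReal hε'] at this

/-- Weak convergence to the standard normal law together with convergence of the second moments
implies convergence in Mallows distance. -/
theorem tendsto_mallowsSq_gaussianReal {ν : ℕ → Measure ℝ} [∀ k, IsProbabilityMeasure (ν k)]
    (hν : ∀ t, Tendsto (fun k => charFun (ν k) t) atTop (𝓝 (charFun (gaussianReal 0 1) t)))
    (h2 : ∀ ε : ℝ, 0 < ε →
      ∀ᶠ k in atTop, ∫⁻ x, ENNReal.ofReal (x ^ 2) ∂(ν k) ≤ ENNReal.ofReal (1 + ε)) :
    Tendsto (fun k => mallowsSq (ν k) (gaussianReal 0 1)) atTop (𝓝 0) := by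
  let N : Measure ℝ := gaussianReal 0 1
  let U : Measure ℝ := volume.restrict (Ioo (0 : ℝ) 1)
  have hN : ∫⁻ p, ENNReal.ofReal (quantile N p ^ 2) ∂U = ENNReal.ofReal 1 := by
    rw [lintegral_quantile_sq, ← ofReal_integral_eq_lintegral_ofReal (integrable_sq_gaussianReal 1)
      (Eventually.of_forall fun x => sq_nonneg x), integral_sq_gaussianReal]
    simp
  have hq := aemeasurable_quantile N
  have hqk := fun k => aemeasurable_quantile (ν k)
  -- Pointwise the quantile sum tends to `2 quantile N p`, and `N` has second moment `1`; hence the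
  -- constant `4`.
  have hfatou : ENNReal.ofReal 4 ≤ liminf (fun k =>
      ∫⁻ p, ENNReal.ofReal ((quantile (ν k) p + quantile N p) ^ 2) ∂U) atTop := by
    refine le_trans (le_of_eq ?_) (lintegral_liminf_le' fun k =>
      (((hqk k).add hq).pow_const 2).ennreal_ofReal)
    have e : ∫⁻ p, liminf (fun k => ENNReal.ofReal ((quantile (ν k) p + quantile N p) ^ 2)) atTop
        ∂U = ∫⁻ p, ENNReal.ofReal 4 * ENNReal.ofReal (quantile N p ^ 2) ∂U := by
      refine lintegral_congr_ae ((ae_restrict_iff' measurableSet_Ioo).2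
        (Eventually.of_forall fun p hp => ?_))
      have := (ENNReal.tendsto_ofReal
        (((tendsto_quantile_gaussianReal hν hp).add_const (quantile N p)).pow 2)).liminf_eq
      simp only
      rw [this, ← ENNReal.ofReal_mul (by norm_num)]
      congr 1
      simp only [N]; ring
    rw [e, lintegral_const_mul' _ _ ENNReal.ofReal_ne_top, hN]
    simp
  refine tendsto_zero_of_forall_le_ofReal fun ε hε => ?_
  have h4 : ENNReal.ofReal (4 - ε / 3) < ENNReal.ofReal 4 :=
    (ENNReal.ofReal_lt_ofReal_iff (by norm_num)).2 (by linarith)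
  filter_upwards [eventually_lt_of_lt_liminf (h4.trans_le hfatou), h2 (ε / 3) (by positivity)]
    with k hk1 hk2
  -- Parallelogram law: the two integrals add up to at most `2(1 + ε/3) + 2`. Since the first
  -- exceeds `4 - ε/3`, at most `ε` remains for the second.
  have hsum : (∫⁻ p, ENNReal.ofReal ((quantile (ν k) p + quantile N p) ^ 2) ∂U) +
      mallowsSq (ν k) N ≤ ENNReal.ofReal (4 + 2 * ε / 3) := by
    have hm : AEMeasurable (fun p => ENNReal.ofReal ((quantile (ν k) p + quantile N p) ^ 2)) U :=
      (((hqk k).add hq).pow_const 2).ennreal_ofReal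
    have hm2 : AEMeasurable (fun p => ENNReal.ofReal (quantile (ν k) p ^ 2)) U :=
      ((hqk k).pow_const 2).ennreal_ofReal
    rw [mallowsSq, ← lintegral_add_left' hm]
    have e : ∀ p, ENNReal.ofReal ((quantile (ν k) p + quantile N p) ^ 2) +
        ENNReal.ofReal ((quantile (ν k) p - quantile N p) ^ 2) =
        ENNReal.ofReal 2 * ENNReal.ofReal (quantile (ν k) p ^ 2) +
          ENNReal.ofReal 2 * ENNReal.ofReal (quantile N p ^ 2) := fun p => by
      rw [← ENNReal.ofReal_add (by positivity) (by positivity),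
        ← ENNReal.ofReal_mul zero_le_two, ← ENNReal.ofReal_mul zero_le_two,
        ← ENNReal.ofReal_add (by positivity) (by positivity)]
      congr 1; ring
    simp_rw [e]
    rw [lintegral_add_left' (hm2.const_mul _), lintegral_const_mul' _ _ ENNReal.ofReal_ne_top,
      lintegral_const_mul' _ _ ENNReal.ofReal_ne_top, hN, lintegral_quantile_sq]
    calc _ ≤ ENNReal.ofReal 2 * ENNReal.ofReal (1 + ε / 3) +
          ENNReal.ofReal 2 * ENNReal.ofReal 1 := by gcongr
      _ = _ := by
        rw [← ENNReal.ofReal_mul zero_le_two, ← ENNReal.ofReal_mul zero_le_two,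
          ← ENNReal.ofReal_add (by positivity) (by positivity)]
        congr 1; ring
  have hfin : (∫⁻ p, ENNReal.ofReal ((quantile (ν k) p + quantile N p) ^ 2) ∂U) ≠ ⊤ :=
    ((le_self_add.trans hsum).trans_lt ENNReal.ofReal_lt_top).ne
  refine ENNReal.le_of_add_le_add_left hfin (hsum.trans ?_)
  calc ENNReal.ofReal (4 + 2 * ε / 3) ≤ ENNReal.ofReal (4 - ε / 3) + ENNReal.ofReal ε := by
        -- For large `ε` the number `4 - ε/3` is negative and `ENNReal.ofReal` truncates it to `0`.
        rcases le_total 0 (4 - ε / 3) with h | h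
        · rw [← ENNReal.ofReal_add h hε.le]
          exact ENNReal.ofReal_le_ofReal (by linarith)
        · rw [ENNReal.ofReal_of_nonpos h, zero_add]
          exact ENNReal.ofReal_le_ofReal (by linarith)
    _ ≤ _ := by gcongr

/-! ### Studentization -/

/-- The truncated square `min (x², M²)`. -/
noncomputable def truncSq (M : ℝ) : BoundedContinuousFunction ℝ ℝ :=
  BoundedContinuousFunction.ofNormedAddCommGroup (fun x => min (x ^ 2) (M ^ 2)) (by fun_prop) (M ^ 2)
    fun x => by
      rw [Real.norm_of_nonneg (le_min (sq_nonneg x) (sq_nonneg M))]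
      exact min_le_right _ _

theorem truncSq_apply (M x : ℝ) : truncSq M x = min (x ^ 2) (M ^ 2) := rfl

theorem tendsto_integral_truncSq (v : ℝ≥0) :
    Tendsto (fun M : ℕ => ∫ x, truncSq M x ∂(gaussianReal 0 v)) atTop (𝓝 v) := by
  rw [← integral_sq_gaussianReal v]
  refine tendsto_integral_of_dominated_convergence (fun x => x ^ 2)
    (fun M => (truncSq M).continuous.aestronglyMeasurable) (integrable_sq_gaussianReal v)
    (fun M => Eventually.of_forall fun x => ?_) (Eventually.of_forall fun x => ?_)
  · rw [truncSq_apply, Real.norm_of_nonneg (le_min (sq_nonneg _) (sq_nonneg _))]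
    exact min_le_left _ _
  · refine tendsto_const_nhds.congr' ?_
    filter_upwards [eventually_ge_atTop ⌈|x|⌉₊] with M hM
    rw [truncSq_apply, min_eq_left]
    rw [← sq_abs x]
    have : |x| ≤ M := Nat.ceil_le.1 hM
    gcongr

section Studentize

variable {Ω : Type*} [MeasurableSpace Ω] {μ : ℕ → Measure Ω} [∀ k, IsProbabilityMeasure (μ k)]
  {Z D : ℕ → Ω → ℝ} {v : ℝ≥0}

theorem integral_sq_le_of_lintegral_le {μ : Measure Ω} {Y : Ω → ℝ} (hY : AEMeasurable Y μ) {b : ℝ}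
    (hb : 0 ≤ b) (h : ∫⁻ ω, ENNReal.ofReal (Y ω ^ 2) ∂μ ≤ ENNReal.ofReal b) :
    Integrable (fun ω => Y ω ^ 2) μ ∧ ∫ ω, Y ω ^ 2 ∂μ ≤ b := by
  have hm : AEStronglyMeasurable (fun ω => Y ω ^ 2) μ := (hY.pow_const 2).aestronglyMeasurable
  constructor
  · refine ⟨hm, ?_⟩
    rw [hasFiniteIntegral_iff_ofReal (Eventually.of_forall fun z => sq_nonneg _)]
    exact h.trans_lt ENNReal.ofReal_lt_top
  · rw [integral_eq_lintegral_of_nonneg_ae (Eventually.of_forall fun z => sq_nonneg _) hm]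
    exact ENNReal.toReal_le_of_le_ofReal hb h

/-- Asymptotic normality with convergent second moments forces uniform integrability of the
squares. -/
theorem eventually_tail_le (hZm : ∀ k, AEMeasurable (Z k) (μ k))
    (hZ : ∀ t, Tendsto (fun k => charFun ((μ k).map (Z k)) t) atTop
      (𝓝 (charFun (gaussianReal 0 v) t)))
    (hZ2 : ∀ ε : ℝ, 0 < ε →
      ∀ᶠ k in atTop, ∫⁻ ω, ENNReal.ofReal (Z k ω ^ 2) ∂(μ k) ≤ ENNReal.ofReal (v + ε))
    {ε : ℝ} (hε : 0 < ε) :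
    ∃ M : ℝ, ∀ᶠ k in atTop, Integrable (fun ω => Z k ω ^ 2) (μ k) ∧
      ∫ ω, (Z k ω ^ 2 - truncSq M (Z k ω)) ∂(μ k) ≤ ε := by
  -- The three losses of `ε/3` come from truncating the Gaussian moment, from weak convergence, and
  -- from the bound on the full second moment.
  obtain ⟨M, hM⟩ := ((tendsto_integral_truncSq v).eventually
    (lt_mem_nhds (by linarith : (v : ℝ) - ε / 3 < v))).exists
  refine ⟨M, ?_⟩
  have hprob : ∀ k, IsProbabilityMeasure ((μ k).map (Z k)) := fun k =>
    Measure.isProbabilityMeasure_map (hZm k)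
  have hweak : Tendsto (β := ProbabilityMeasure ℝ) (fun k => ⟨(μ k).map (Z k), hprob k⟩) atTop
      (𝓝 ⟨gaussianReal 0 v, inferInstance⟩) := ProbabilityMeasure.tendsto_of_tendsto_charFun hZ
  have hint := ProbabilityMeasure.tendsto_iff_forall_integral_tendsto.1 hweak (truncSq M)
  simp only [ProbabilityMeasure.coe_mk] at hint
  filter_upwards [hint.eventually (lt_mem_nhds (sub_lt_self _ (by positivity : 0 < ε / 3))),
    hZ2 (ε / 3) (by positivity)] with k hk1 hk2
  obtain ⟨hi, hle⟩ := integral_sq_le_of_lintegral_le (hZm k) (by positivity) hk2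
  refine ⟨hi, ?_⟩
  rw [integral_map (hZm k) (truncSq M).continuous.aestronglyMeasurable] at hk1
  have hi2 : Integrable (fun ω => truncSq M (Z k ω)) (μ k) := by
    refine hi.mono' ((truncSq M).continuous.measurable.comp_aemeasurable
      (hZm k)).aestronglyMeasurable (Eventually.of_forall fun ω => ?_)
    rw [truncSq_apply, Real.norm_of_nonneg (le_min (sq_nonneg _) (sq_nonneg _))]
    exact min_le_left _ _
  rw [integral_sub hi hi2]
  linarith

variable {d δ : ℝ}

/-- Replacing a consistent estimator of the variance, bounded away from zero, by its limit is
negligible in mean square. -/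
theorem eventually_integral_studentize_sub_sq_le (hd : 0 < d) (hδ : 0 < δ)
    (hZm : ∀ k, AEMeasurable (Z k) (μ k)) (hDm : ∀ k, AEMeasurable (D k) (μ k))
    (hZ : ∀ t, Tendsto (fun k => charFun ((μ k).map (Z k)) t) atTop
      (𝓝 (charFun (gaussianReal 0 v) t)))
    (hZ2 : ∀ ε : ℝ, 0 < ε →
      ∀ᶠ k in atTop, ∫⁻ ω, ENNReal.ofReal (Z k ω ^ 2) ∂(μ k) ≤ ENNReal.ofReal (v + ε))
    (hDδ : ∀ k, ∀ᵐ ω ∂(μ k), δ ≤ D k ω)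
    (hD : ∀ ε : ℝ, 0 < ε → Tendsto (fun k => μ k {ω | ε ≤ |D k ω - d|}) atTop (𝓝 0))
    {ε : ℝ} (hε : 0 < ε) :
    ∀ᶠ k in atTop,
      Integrable (fun ω => (Z k ω / √(2 * Real.pi * D k ω) - Z k ω / √(2 * Real.pi * d)) ^ 2)
        (μ k) ∧
      ∫ ω, (Z k ω / √(2 * Real.pi * D k ω) - Z k ω / √(2 * Real.pi * d)) ^ 2 ∂(μ k) ≤ ε := by
  have hpi := Real.pi_pos
  let φ : ℝ → ℝ := fun x => (√(2 * Real.pi * x))⁻¹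
  have hφ : ContinuousAt φ d := by
    refine ContinuousAt.inv₀ (by fun_prop) ?_
    positivity
  have hφδ : ∀ x, δ ≤ x → 0 ≤ φ x ∧ φ x ≤ φ δ := fun x hx => by
    refine ⟨by positivity, ?_⟩
    simp only [φ]
    gcongr
  -- `B` bounds the squared error of `φ` on all of `[δ, ∞)`, and `v + 1` in `η` eventually bounds
  -- the second moment of `Z`.
  let B : ℝ := (φ δ + φ d) ^ 2
  have hφδ0 : 0 < φ δ := by simp only [φ]; positivity
  have hφd0 : 0 < φ d := by simp only [φ]; positivity
  have hB : 0 < B := by positivity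
  let η : ℝ := ε / (2 * (v + 1))
  have hη : 0 < η := by positivity
  obtain ⟨ρ, hρ, hclose⟩ : ∃ ρ > 0, ∀ x, |x - d| < ρ → (φ x - φ d) ^ 2 ≤ η := by
    obtain ⟨ρ, hρ, h⟩ := Metric.continuousAt_iff.1 hφ (√η) (by positivity)
    refine ⟨ρ, hρ, fun x hx => ?_⟩
    have := h (by rwa [Real.dist_eq])
    rw [Real.dist_eq] at this
    rw [← sq_abs, ← Real.sq_sqrt hη.le]
    gcongr
  obtain ⟨M, hM⟩ := eventually_tail_le hZm hZ hZ2 (ε := ε / (4 * B)) (by positivity)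
  have hDM : Tendsto (fun k => M ^ 2 * (μ k).real {ω | ρ ≤ |D k ω - d|}) atTop (𝓝 0) := by
    have := ((ENNReal.tendsto_toReal ENNReal.zero_ne_top).comp (hD ρ hρ)).const_mul (M ^ 2)
    simpa [Measure.real] using this
  filter_upwards [hM, hZ2 1 one_pos,
    hDM.eventually (gt_mem_nhds (by positivity : 0 < ε / (4 * B)))] with k hk1 hk2 hk3
  obtain ⟨hi, htail⟩ := hk1
  have hE := (integral_sq_le_of_lintegral_le (hZm k) (by positivity) hk2).2
  let A : Set Ω := {ω | ρ ≤ |D k ω - d|}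
  have hA : NullMeasurableSet A (μ k) :=
    nullMeasurableSet_le aemeasurable_const ((hDm k).sub_const d).abs
  have hi2 : Integrable (fun ω => truncSq M (Z k ω)) (μ k) := by
    refine hi.mono' ((truncSq M).continuous.measurable.comp_aemeasurable
      (hZm k)).aestronglyMeasurable (Eventually.of_forall fun ω => ?_)
    rw [truncSq_apply, Real.norm_of_nonneg (le_min (sq_nonneg _) (sq_nonneg _))]
    exact min_le_left _ _
  have hiA : Integrable (A.indicator fun _ => M ^ 2) (μ k) :=
    (integrable_const _).indicator₀ hA
  have hi3 : Integrable (fun ω => Z k ω ^ 2 - truncSq M (Z k ω)) (μ k) := hi.sub hi2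
  have hi4 : Integrable (fun ω => A.indicator (fun _ => M ^ 2) ω +
      (Z k ω ^ 2 - truncSq M (Z k ω))) (μ k) := hiA.add hi3
  -- Off `A` the estimator is close to `d` and the factor is at most `η`. On `A` the factor is at
  -- most `B`, and `Z²` splits into its truncation, at most `M²`, and its tail.
  have hpt : ∀ᵐ ω ∂(μ k), (Z k ω / √(2 * Real.pi * D k ω) - Z k ω / √(2 * Real.pi * d)) ^ 2 ≤
      η * Z k ω ^ 2 + B * (A.indicator (fun _ => M ^ 2) ω +
        (Z k ω ^ 2 - truncSq M (Z k ω))) := by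
    filter_upwards [hDδ k] with ω hω
    have e : (Z k ω / √(2 * Real.pi * D k ω) - Z k ω / √(2 * Real.pi * d)) ^ 2 =
        (φ (D k ω) - φ d) ^ 2 * Z k ω ^ 2 := by
      simp only [φ, div_eq_mul_inv]; ring
    rw [e]
    have hmin : truncSq M (Z k ω) ≤ Z k ω ^ 2 := min_le_left _ _
    by_cases hωA : ω ∈ A
    · rw [indicator_of_mem hωA]
      have h1 : (φ (D k ω) - φ d) ^ 2 ≤ B := by
        obtain ⟨h2, h3⟩ := hφδ _ hω
        refine sq_le_sq' ?_ ?_ <;> linarith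
      have h2 : Z k ω ^ 2 ≤ M ^ 2 + (Z k ω ^ 2 - truncSq M (Z k ω)) := by
        have : truncSq M (Z k ω) ≤ M ^ 2 := min_le_right _ _
        linarith
      calc (φ (D k ω) - φ d) ^ 2 * Z k ω ^ 2 ≤
          B * (M ^ 2 + (Z k ω ^ 2 - truncSq M (Z k ω))) := by gcongr
        _ ≤ _ := le_add_of_nonneg_left (by positivity)
    · rw [indicator_of_notMem hωA]
      have h1 := hclose (D k ω) (not_le.1 hωA)
      have h2 : 0 ≤ B * (0 + (Z k ω ^ 2 - truncSq M (Z k ω))) :=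
        mul_nonneg hB.le (by linarith)
      have h3 : (φ (D k ω) - φ d) ^ 2 * Z k ω ^ 2 ≤ η * Z k ω ^ 2 := by gcongr
      linarith
  have hbi : Integrable (fun ω => η * Z k ω ^ 2 + B * (A.indicator (fun _ => M ^ 2) ω +
      (Z k ω ^ 2 - truncSq M (Z k ω)))) (μ k) :=
    (hi.const_mul η).add (hi4.const_mul B)
  have hTm : AEStronglyMeasurable
      (fun ω => (Z k ω / √(2 * Real.pi * D k ω) - Z k ω / √(2 * Real.pi * d)) ^ 2) (μ k) := by
    have h1 := hZm k
    have h2 := hDm k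
    exact AEMeasurable.aestronglyMeasurable (by fun_prop)
  have hTi := hbi.mono' hTm (by
    filter_upwards [hpt] with ω hω
    rwa [Real.norm_of_nonneg (sq_nonneg _)])
  refine ⟨hTi, (integral_mono_ae hTi hbi hpt).trans ?_⟩
  rw [integral_add (hi.const_mul η) (hi4.const_mul B), integral_const_mul,
    integral_const_mul, integral_add hiA hi3, integral_indicator₀ hA, setIntegral_const,
    smul_eq_mul, mul_comm ((μ k).real A)]
  have h1 : η * ∫ ω, Z k ω ^ 2 ∂(μ k) ≤ ε / 2 := by
    calc η * ∫ ω, Z k ω ^ 2 ∂(μ k) ≤ η * (v + 1) := by gcongr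
      _ = ε / 2 := by simp only [η]; field_simp
  have h2 : B * (M ^ 2 * (μ k).real A + ∫ ω, (Z k ω ^ 2 - truncSq M (Z k ω)) ∂(μ k)) ≤
      ε / 2 := by
    calc _ ≤ B * (ε / (4 * B) + ε / (4 * B)) := by
          gcongr
      _ = ε / 2 := by field_simp; ring
  linarith

/-- The statistics with estimated and with limiting scale differ by a quantity vanishing in mean
square; this transfers both the characteristic functions and the second-moment bound. -/
theorem tendsto_mallowsSq_studentize (hd : 0 < d) (hδ : 0 < δ) (hv : (v : ℝ) = 2 * Real.pi * d)
    (hZm : ∀ k, AEMeasurable (Z k) (μ k)) (hDm : ∀ k, AEMeasurable (D k) (μ k))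
    (hZ : ∀ t, Tendsto (fun k => charFun ((μ k).map (Z k)) t) atTop
      (𝓝 (charFun (gaussianReal 0 v) t)))
    (hZ2 : ∀ ε : ℝ, 0 < ε →
      ∀ᶠ k in atTop, ∫⁻ ω, ENNReal.ofReal (Z k ω ^ 2) ∂(μ k) ≤ ENNReal.ofReal (v + ε))
    (hDδ : ∀ k, ∀ᵐ ω ∂(μ k), δ ≤ D k ω)
    (hD : ∀ ε : ℝ, 0 < ε → Tendsto (fun k => μ k {ω | ε ≤ |D k ω - d|}) atTop (𝓝 0)) :
    Tendsto (fun k => mallowsSq ((μ k).map fun ω => Z k ω / √(2 * Real.pi * D k ω))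
      (gaussianReal 0 1)) atTop (𝓝 0) := by
  have hpi := Real.pi_pos
  have hv0 : 0 < (v : ℝ) := by rw [hv]; positivity
  let T : ℕ → Ω → ℝ := fun k ω => Z k ω / √(2 * Real.pi * D k ω)
  let W : ℕ → Ω → ℝ := fun k ω => Z k ω / √(2 * Real.pi * d)
  have hTm : ∀ k, AEMeasurable (T k) (μ k) := fun k => by
    have h1 := hZm k
    have h2 := hDm k
    fun_prop
  have hWm : ∀ k, AEMeasurable (W k) (μ k) := fun k => (hZm k).div_const _
  have hprob : ∀ k, IsProbabilityMeasure ((μ k).map (T k)) := fun k =>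
    Measure.isProbabilityMeasure_map (hTm k)
  have hdiff := fun ε (hε : (0 : ℝ) < ε) =>
    eventually_integral_studentize_sub_sq_le hd hδ hZm hDm hZ hZ2 hDδ hD hε
  have hW : ∀ k ω, W k ω ^ 2 = Z k ω ^ 2 / v := fun k ω => by
    simp only [W]
    rw [div_pow, hv, Real.sq_sqrt (by positivity)]
  refine tendsto_mallowsSq_gaussianReal (fun t => ?_) fun ε hε => ?_
  · have hchar : ∀ (k : ℕ) (Y : Ω → ℝ), AEMeasurable Y (μ k) →
        charFun ((μ k).map Y) t = ∫ ω, Complex.exp (((t * Y ω : ℝ) : ℂ) * Complex.I) ∂(μ k) :=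
      fun k Y hY => by
        rw [charFun_apply_real, integral_map hY (by fun_prop)]
        push_cast; rfl
    have hWlim : Tendsto (fun k => charFun ((μ k).map (W k)) t) atTop
        (𝓝 (charFun (gaussianReal 0 1) t)) := by
      have h1 := hZ ((√(2 * Real.pi * d))⁻¹ * t)
      have e1 : ∀ k, charFun ((μ k).map (W k)) t =
          charFun ((μ k).map (Z k)) ((√(2 * Real.pi * d))⁻¹ * t) := fun k => by
        rw [← charFun_map_mul, AEMeasurable.map_map_of_aemeasurable (by fun_prop) (hZm k)]
        congr 2
        funext ω
        simp only [W, Function.comp]; ring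
      simp_rw [e1]
      convert h1 using 2
      rw [charFun_gaussianReal, charFun_gaussianReal]
      congr 1
      have hsq : ((√(2 * Real.pi * d))⁻¹ * t) ^ 2 = t ^ 2 / v := by
        rw [mul_pow, inv_pow, hv, Real.sq_sqrt (by positivity)]; field_simp
      have : (((v : ℝ) * ((√(2 * Real.pi * d))⁻¹ * t) ^ 2 : ℝ) : ℂ) = ((t ^ 2 : ℝ) : ℂ) := by
        rw [hsq]; congr 1; field_simp
      push_cast at this
      simp only [Complex.ofReal_zero, mul_zero, zero_mul, NNReal.coe_one, Complex.ofReal_one,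
        one_mul, zero_sub]
      push_cast
      rw [this]
    have hdist : Tendsto (fun k => charFun ((μ k).map (T k)) t - charFun ((μ k).map (W k)) t)
        atTop (𝓝 0) := by
      rw [Metric.tendsto_nhds]
      intro ε hε
      -- Used through `|x| ≤ (ρ + x²/ρ)/2`, which bounds a first absolute moment by a second moment
      -- of size `ρ²`.
      let ρ : ℝ := ε / (2 * (|t| + 1))
      have hρ : 0 < ρ := by positivity
      filter_upwards [hdiff (ρ ^ 2) (by positivity)] with k hk
      rw [dist_zero_right, hchar k _ (hTm k), hchar k _ (hWm k)]
      have hi : ∀ Y : Ω → ℝ, AEMeasurable Y (μ k) →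
          Integrable (fun ω => Complex.exp (((t * Y ω : ℝ) : ℂ) * Complex.I)) (μ k) := fun Y hY => by
        refine (integrable_const (1 : ℝ)).mono' (AEMeasurable.aestronglyMeasurable (by fun_prop))
          (Eventually.of_forall fun z => ?_)
        rw [Complex.norm_exp_ofReal_mul_I]
      rw [← integral_sub (hi _ (hTm k)) (hi _ (hWm k))]
      have hk' : Integrable (fun ω => (T k ω - W k ω) ^ 2 / ρ) (μ k) := hk.1.div_const ρ
      have hb : Integrable (fun ω => |t| * ((ρ + (T k ω - W k ω) ^ 2 / ρ) / 2)) (μ k) :=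
        (((integrable_const ρ).add hk').div_const 2).const_mul |t|
      calc _ ≤ ∫ ω, |t| * ((ρ + (T k ω - W k ω) ^ 2 / ρ) / 2) ∂(μ k) := by
            refine norm_integral_le_of_norm_le hb (Eventually.of_forall fun ω => ?_)
            have e : Complex.exp (((t * T k ω : ℝ) : ℂ) * Complex.I) -
                Complex.exp (((t * W k ω : ℝ) : ℂ) * Complex.I) =
                Complex.exp (((t * W k ω : ℝ) : ℂ) * Complex.I) *
                  (Complex.exp (Complex.I * ((t * (T k ω - W k ω) : ℝ) : ℂ)) - 1) := by
              rw [mul_sub, ← Complex.exp_add, mul_one]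
              congr 2
              push_cast; ring
            rw [e, norm_mul, Complex.norm_exp_ofReal_mul_I, one_mul]
            refine Real.norm_exp_I_mul_ofReal_sub_one_le.trans ?_
            rw [norm_mul, Real.norm_eq_abs, Real.norm_eq_abs]
            gcongr
            rw [le_div_iff₀ two_pos, ← sq_abs]
            have : |T k ω - W k ω| * 2 = (|T k ω - W k ω| * 2 * ρ) / ρ := by field_simp
            rw [this, show ρ + |T k ω - W k ω| ^ 2 / ρ = (ρ ^ 2 + |T k ω - W k ω| ^ 2) / ρ by
              field_simp]
            gcongr
            nlinarith [sq_nonneg (|T k ω - W k ω| - ρ)]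
        _ = |t| * ((ρ + (∫ ω, (T k ω - W k ω) ^ 2 ∂(μ k)) / ρ) / 2) := by
            rw [integral_const_mul, integral_div, integral_add (integrable_const ρ) hk',
              integral_const, probReal_univ, one_smul, integral_div ρ]
        _ ≤ |t| * ((ρ + ρ ^ 2 / ρ) / 2) := by
            gcongr
            exact hk.2
        _ = |t| * ρ := by field_simp; ring
        _ ≤ (|t| + 1) * ρ := by gcongr; linarith
        _ = ε / 2 := by simp only [ρ]; field_simp
        _ < ε := by linarith
    simpa using hdist.add hWlim
  -- Used in `(a + b)² ≤ (1 + θ) a² + (1 + θ⁻¹) b²`; the choice ensures `(1 + θ)² ≤ 1 + 3θ ≤ 1 +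
  -- ε/2`.
  · let θ : ℝ := min 1 (ε / 6)
    have hθ : 0 < θ := by positivity
    have hθ1 : θ ≤ 1 := min_le_left _ _
    have hθε : θ ≤ ε / 6 := min_le_right _ _
    filter_upwards [hdiff (ε / 2 / (1 + θ⁻¹)) (by positivity), hZ2 (v * θ) (by positivity)]
      with k hk1 hk2
    obtain ⟨hi, hE⟩ := integral_sq_le_of_lintegral_le (hZm k) (by positivity) hk2
    have hiW : Integrable (fun ω => W k ω ^ 2) (μ k) := by
      simp_rw [hW]; exact hi.div_const _
    have hEW : ∫ ω, W k ω ^ 2 ∂(μ k) ≤ 1 + θ := by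
      simp_rw [hW]
      rw [integral_div, div_le_iff₀ hv0]
      linarith
    rw [lintegral_map' (by fun_prop) (hTm k)]
    have hb : Integrable (fun ω => (1 + θ) * W k ω ^ 2 + (1 + θ⁻¹) * (T k ω - W k ω) ^ 2) (μ k) :=
      (hiW.const_mul _).add (hk1.1.const_mul _)
    calc _ ≤ ∫⁻ ω, ENNReal.ofReal ((1 + θ) * W k ω ^ 2 + (1 + θ⁻¹) * (T k ω - W k ω) ^ 2)
          ∂(μ k) := by
          refine lintegral_mono fun ω => ENNReal.ofReal_le_ofReal ?_
          have h1 : (1 + θ) * W k ω ^ 2 + (1 + θ⁻¹) * (T k ω - W k ω) ^ 2 - T k ω ^ 2 =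
              θ⁻¹ * (θ * W k ω - (T k ω - W k ω)) ^ 2 := by field_simp; ring
          have h2 : 0 ≤ θ⁻¹ * (θ * W k ω - (T k ω - W k ω)) ^ 2 := by positivity
          change T k ω ^ 2 ≤ _
          linarith
      _ = ENNReal.ofReal (∫ ω, ((1 + θ) * W k ω ^ 2 + (1 + θ⁻¹) * (T k ω - W k ω) ^ 2)
          ∂(μ k)) := (ofReal_integral_eq_lintegral_ofReal hb
            (Eventually.of_forall fun ω => by positivity)).symm
      _ ≤ ENNReal.ofReal (1 + ε) := by
          refine ENNReal.ofReal_le_ofReal ?_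
          rw [integral_add (hiW.const_mul _) (hk1.1.const_mul _), integral_const_mul,
            integral_const_mul]
          have h1 : (1 + θ) * ∫ ω, W k ω ^ 2 ∂(μ k) ≤ (1 + θ) * (1 + θ) := by gcongr
          have h2 : (1 + θ⁻¹) * ∫ ω, (T k ω - W k ω) ^ 2 ∂(μ k) ≤ ε / 2 := by
            calc _ ≤ (1 + θ⁻¹) * (ε / 2 / (1 + θ⁻¹)) := by
                  gcongr
                  exact hk1.2
              _ = ε / 2 := by field_simp
          nlinarith

end Studentize

/-! ### Consistency of the bootstrap, uniformly in its parameters -/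

/-- A triangular-array form: innovation law, filter and centring may vary arbitrarily with `k`,
since only `K`, `C`, `δ` and the limiting variance enter. -/
theorem tendsto_mallowsSq_bootstrap {K C δ d : ℝ} (hK : 0 ≤ K) (hδ : 0 < δ) (hd : 0 < d)
    {n : ℕ → ℕ} (hn : Tendsto n atTop atTop) (hn1 : ∀ k, 1 ≤ n k) {q : ℕ → Measure ℝ}
    [∀ k, IsProbabilityMeasure (q k)] {s : ℕ → ℝ} {c : ℕ → ℕ → ℝ} {m : ℕ → ℝ}
    (hq : ∀ k, IsInnovation (q k) (s k) K) (hc : ∀ k, Summable fun j => |c k j|)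
    (hC : ∀ k, ∑' j, |c k j| ≤ C)
    (hV : Tendsto (fun k => meanVar (c k) (s k) (n k)) atTop (𝓝 (2 * Real.pi * d)))
    {D : ℕ → (ℤ → ℝ) → ℝ} (hDm : ∀ k, AEMeasurable (D k) (innovLaw (q k)))
    (hDδ : ∀ k, ∀ᵐ e ∂(innovLaw (q k)), δ ≤ D k e)
    (hD : ∀ ε : ℝ, 0 < ε →
      Tendsto (fun k => innovLaw (q k) {e | ε ≤ |D k e - d|}) atTop (𝓝 0)) :
    Tendsto (fun k => mallowsSq ((innovLaw (q k)).map fun e =>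
      scaledMean (pseudoSample (c k) (m k) (n k) e) (m k) / √(2 * Real.pi * D k e))
      (gaussianReal 0 1)) atTop (𝓝 0) := by
  have hpi := Real.pi_pos
  let v : ℝ≥0 := ⟨2 * Real.pi * d, by positivity⟩
  refine tendsto_mallowsSq_studentize (v := v) hd hδ rfl (fun k => ?_) hDm (fun t => ?_)
    (fun ε hε => ?_) hDδ hD
  · have := (measurable_sampleMean (n k)).comp_aemeasurable
      ((hq k).aemeasurable_pseudoSample (hc k) (m k) (n k))
    exact (this.sub_const (m k)).const_mul _
  · have hexp : Tendsto (fun k =>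
        ((Real.exp (-(meanVar (c k) (s k) (n k) * t ^ 2 / 2)) : ℝ) : ℂ)) atTop
        (𝓝 (charFun (gaussianReal 0 v) t)) := by
      have hcont : Continuous fun y : ℝ => ((Real.exp (-(y * t ^ 2 / 2)) : ℝ) : ℂ) := by fun_prop
      have hchar : charFun (gaussianReal 0 v) t =
          ((Real.exp (-(2 * Real.pi * d * t ^ 2 / 2)) : ℝ) : ℂ) := by
        have hv : ((v : ℝ) : ℂ) = 2 * Real.pi * d := by
          have : (v : ℝ) = 2 * Real.pi * d := rfl
          rw [this]; push_cast; rfl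
        rw [charFun_gaussianReal, hv]
        push_cast
        congr 1
        ring
      rw [hchar]
      exact (hcont.tendsto _).comp hV
    have hsmall : Tendsto (fun k => C / √(n k) * C ^ 2 *
        (4 * (1 + K) * |t| ^ 3 + (1 + K) ^ 2 * t ^ 4 * (C / √(n k)))) atTop (𝓝 0) := by
      have h1 : Tendsto (fun k => C / √(n k : ℝ)) atTop (𝓝 0) :=
        (tendsto_const_nhds.div_atTop (Real.tendsto_sqrt_atTop.comp
          (tendsto_natCast_atTop_atTop.comp hn)))
      have hcont : Continuous fun y : ℝ => y * C ^ 2 *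
        (4 * (1 + K) * |t| ^ 3 + (1 + K) ^ 2 * t ^ 4 * y) := by fun_prop
      have h3 := (hcont.tendsto 0).comp h1
      simp only [zero_mul] at h3
      exact h3
    have hdiff := squeeze_zero_norm
      (fun k => (hq k).norm_charFun_scaledMean_sub_le hK (hc k) (hC k) (m k) (hn1 k) t) hsmall
    simpa using hdiff.add hexp
  · have hlt : 2 * Real.pi * d < (v : ℝ) + ε := lt_add_of_pos_right _ hε
    filter_upwards [hV.eventually (gt_mem_nhds hlt)] with k hk
    exact ((hq k).lintegral_scaledMean_sq_le (hc k) (m k) (hn1 k)).trans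
      (ENNReal.ofReal_le_ofReal hk.le)

/-- If no thresholds worked, counterexamples with `N = k + 1` and `η = 1/(k + 1)` would form a
sequence contradicting the previous limit. Uniformity permits application to each data realization
separately, without subsequences. -/
theorem exists_uniform_mallowsSq_bootstrap_le {K C δ d ε : ℝ} (hK : 0 ≤ K) (hδ : 0 < δ)
    (hd : 0 < d) (hε : 0 < ε) :
    ∃ N : ℕ, 1 ≤ N ∧ ∃ η : ℝ, 0 < η ∧ ∀ n ≥ N, ∀ (q : Measure ℝ) (s : ℝ) (c : ℕ → ℝ) (m : ℝ)
      (D : (ℤ → ℝ) → ℝ), IsProbabilityMeasure q → IsInnovation q s K →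
      (Summable fun j => |c j|) → ∑' j, |c j| ≤ C → |meanVar c s n - 2 * Real.pi * d| ≤ η →
      AEMeasurable D (innovLaw q) → (∀ᵐ e ∂(innovLaw q), δ ≤ D e) →
      innovLaw q {e | η ≤ |D e - d|} ≤ ENNReal.ofReal η →
      mallowsSq ((innovLaw q).map fun e => scaledMean (pseudoSample c m n e) m /
        √(2 * Real.pi * D e)) (gaussianReal 0 1) ≤ ENNReal.ofReal ε := by
  by_contra hcon
  push Not at hcon
  have hη : ∀ k : ℕ, (0 : ℝ) < 1 / ((k : ℝ) + 1) := fun k => by positivity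
  choose n hn q s c m D hqp hq hc hC hV hDm hDδ hD hbad using
    fun k : ℕ => hcon (k + 1) (by omega) (1 / ((k : ℝ) + 1)) (hη k)
  have hη0 : Tendsto (fun k : ℕ => 1 / ((k : ℝ) + 1)) atTop (𝓝 0) :=
    tendsto_one_div_add_atTop_nhds_zero_nat
  have hlim := tendsto_mallowsSq_bootstrap (m := m) hK hδ hd
    (tendsto_atTop_mono (fun k => (Nat.le_succ k).trans (hn k)) tendsto_id)
    (fun k => le_trans (by omega) (hn k)) hq hc hC
    (tendsto_iff_norm_sub_tendsto_zero.2 (squeeze_zero (fun _ => norm_nonneg _) hV hη0))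
    hDm hDδ ?_
  · obtain ⟨k, hk⟩ := (hlim.eventually (gt_mem_nhds (ENNReal.ofReal_pos.2 hε))).exists
    exact absurd hk (not_lt.2 (hbad k).le)
  · intro ε' hε'
    have h0 : Tendsto (fun k : ℕ => ENNReal.ofReal (1 / ((k : ℝ) + 1))) atTop (𝓝 0) := by
      simpa using ENNReal.tendsto_ofReal hη0
    refine tendsto_of_tendsto_of_tendsto_of_le_of_le' tendsto_const_nhds h0
      (Eventually.of_forall fun _ => zero_le) ?_
    filter_upwards [hη0.eventually (gt_mem_nhds hε')] with k hk
    exact (measure_mono fun e (he : ε' ≤ _) => hk.le.trans he).trans (hD k)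

/-! ### The studentized mean of a stationary process -/

section Stationary

variable {Ω : Type*} [MeasurableSpace Ω] {P : Measure Ω} {X : ℤ → Ω → ℝ} {m : ℝ}

theorem IsWeaklyStationary.covariance_eq (h : IsWeaklyStationary P X m) (s t : ℤ) :
    covariance (X s) (X t) P = autocov P X (s - t) := by
  rw [autocov, covariance_comm]
  have := h.cov t 0 (s - t)
  rwa [zero_add, add_sub_cancel] at this

theorem IsWeaklyStationary.autocov_neg (h : IsWeaklyStationary P X m) (k : ℤ) :
    autocov P X (-k) = autocov P X k := by
  have h1 := h.covariance_eq 0 k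
  rw [zero_sub] at h1
  rw [← h1, autocov]

theorem IsWeaklyStationary.lintegral_scaledMean_sq [IsProbabilityMeasure P]
    (h : IsWeaklyStationary P X m) (n : ℕ) :
    ∫⁻ ω, ENNReal.ofReal (scaledMean (sample X n ω) m ^ 2) ∂P =
      ENNReal.ofReal ((∑ t ∈ Finset.range n, ∑ u ∈ Finset.range n,
        autocov P X ((t : ℤ) - (u : ℤ))) / n) := by
  let Y : ℕ → Ω → ℝ := fun t ω => X ((t : ℤ) + 1) ω - m
  have hY : ∀ t, MemLp (Y t) 2 P := fun t => (h.memLp _).sub (memLp_const m)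
  have hint : ∀ t u, Integrable (fun ω => Y t ω * Y u ω) P := fun t u =>
    (hY t).integrable_mul (hY u)
  have hcov : ∀ t u : ℕ, ∫ ω, Y t ω * Y u ω ∂P = autocov P X ((t : ℤ) - (u : ℤ)) := by
    intro t u
    have := h.covariance_eq ((t : ℤ) + 1) ((u : ℤ) + 1)
    rw [covariance, h.mean, h.mean] at this
    rw [show (t : ℤ) - u = (t : ℤ) + 1 - (u + 1) by ring, ← this]
  have hexp : ∀ ω, scaledMean (sample X n ω) m ^ 2 =
      (∑ t ∈ Finset.range n, ∑ u ∈ Finset.range n, Y t ω * Y u ω) / n := by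
    intro ω
    rcases Nat.eq_zero_or_pos n with rfl | hn
    · simp [scaledMean]
    · have hn0 : (n : ℝ) ≠ 0 := by positivity
      have e : sampleMean (sample X n ω) - m = (∑ t ∈ Finset.range n, Y t ω) / n := by
        rw [sampleMean, Finset.sum_range]
        simp only [Y, sample, Finset.sum_sub_distrib, Finset.sum_const, Finset.card_univ,
          Fintype.card_fin, nsmul_eq_mul]
        field_simp
      rw [scaledMean, e, ← Finset.sum_mul_sum, mul_pow, Real.sq_sqrt (Nat.cast_nonneg n)]
      field_simp
  have hint2 : Integrable (fun ω => scaledMean (sample X n ω) m ^ 2) P := by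
    simp_rw [hexp]
    exact (integrable_finsetSum _ fun t _ => integrable_finsetSum _ fun u _ => hint t u).div_const _
  rw [← ofReal_integral_eq_lintegral_ofReal hint2 (Eventually.of_forall fun _ => sq_nonneg _)]
  simp_rw [hexp]
  rw [integral_div, integral_finsetSum _ fun t _ => integrable_finsetSum _ fun u _ => hint t u]
  simp_rw [integral_finsetSum _ fun u _ => hint _ u, hcov]

theorem IsWeaklyStationary.aemeasurable_sample (h : IsWeaklyStationary P X m) (n : ℕ) :
    AEMeasurable (sample X n) P :=
  aemeasurable_pi_iff.2 fun _ => (h.memLp _).aestronglyMeasurable.aemeasurable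

theorem tendsto_mallowsSq_sample [IsProbabilityMeasure P] {f : ℝ → ℝ} {δ : ℝ}
    (hstat : IsWeaklyStationary P X m) (hγ : Summable (fun h : ℤ => |autocov P X h|))
    (hf : f = spectralDensity (autocov P X)) (hf0 : 0 < f 0)
    (hclt : TendstoInDistribution
      (fun (n : ℕ) ω => √(n : ℝ) * (sampleMean (sample X n ω) - m)) atTop
      (id : ℝ → ℝ) (fun _ => P) (gaussianReal 0 (2 * Real.pi * f 0).toNNReal))
    (hδ : 0 < δ) {D : (n : ℕ) → (Fin n → ℝ) → ℝ} (hDm : ∀ n, Measurable (D n))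
    (hDδ : ∀ n ≥ 1, ∀ᵐ ω ∂P, δ ≤ D n (sample X n ω))
    (hD : ToZeroInProb P (fun n ω => ENNReal.ofReal |D n (sample X n ω) - f 0|)) :
    Tendsto (fun n => mallowsSq (P.map fun ω => scaledMean (sample X n ω) m /
      √(2 * Real.pi * D n (sample X n ω))) (gaussianReal 0 1)) atTop (𝓝 0) := by
  have hpi := Real.pi_pos
  have hv : ((2 * Real.pi * f 0).toNNReal : ℝ) = 2 * Real.pi * f 0 :=
    Real.coe_toNNReal _ (by positivity)
  -- The lower bound `δ` is available only for `n ≥ 1`, hence the shift of the index.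
  rw [← tendsto_add_atTop_iff_nat 1]
  refine tendsto_mallowsSq_studentize (μ := fun _ => P)
    (Z := fun k ω => scaledMean (sample X (k + 1) ω) m)
    (D := fun k ω => D (k + 1) (sample X (k + 1) ω)) hf0 hδ hv (fun k => ?_) (fun k => ?_)
    (fun t => ?_) (fun ε hε => ?_) (fun k => hDδ (k + 1) (by omega)) fun ε hε => ?_
  · have := (measurable_sampleMean (k + 1)).comp_aemeasurable (hstat.aemeasurable_sample (k + 1))
    exact (this.sub_const m).const_mul _
  · exact (hDm (k + 1)).comp_aemeasurable (hstat.aemeasurable_sample (k + 1))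
  · have h1 := ProbabilityMeasure.tendsto_iff_tendsto_charFun.1 hclt.tendsto t
    simp only [Measure.map_id] at h1
    exact (tendsto_add_atTop_iff_nat 1).2 h1
  · have hlim := tendsto_cesaro_double_sum hγ
    rw [← two_pi_mul_spectralDensity_zero, ← hf] at hlim
    have hlt : 2 * Real.pi * f 0 < ((2 * Real.pi * f 0).toNNReal : ℝ) + ε := by
      rw [hv]; linarith
    filter_upwards [((tendsto_add_atTop_iff_nat 1).2 hlim).eventually (gt_mem_nhds hlt)] with k hk
    rw [hstat.lintegral_scaledMean_sq]
    exact ENNReal.ofReal_le_ofReal hk.le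
  · have h1 := (tendsto_add_atTop_iff_nat 1).2 (hD (ENNReal.ofReal ε) (ENNReal.ofReal_pos.2 hε))
    refine h1.congr fun k => ?_
    congr 1
    ext ω
    exact ENNReal.ofReal_le_ofReal_iff (abs_nonneg _)

end Stationary

/-! ### The variance of the bootstrap mean -/

/-- The factorization holds where `g` is positive, which is almost everywhere by log-integrability.
-/
theorem meanVar_woldCoeff {g : ℝ → ℝ} (hs : IsSpectralShape g) (hg : LogIntegrable g)
    (hcont : Continuous g) (hc : Summable fun k => |woldCoeff g k|) (n : ℕ) :
    meanVar (woldCoeff g) (innovVar g) n = ∫ l in (-Real.pi)..Real.pi, g l * fejer n l := by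
  have hpi := Real.pi_pos
  rw [meanVar, ← intervalIntegral.integral_const_mul, ← intervalIntegral.integral_const_mul]
  refine intervalIntegral.integral_congr_ae' ?_ ?_
  · rw [← ae_restrict_iff' measurableSet_Ioc]
    filter_upwards [hg.1] with l hl
    have := innovVar_mul_norm_transfer_sq hs hg hcont hc hl
    calc innovVar g * ((2 * Real.pi)⁻¹ * (‖transfer (woldCoeff g) l‖ ^ 2 * fejer n l)) =
        (2 * Real.pi)⁻¹ * (innovVar g * ‖transfer (woldCoeff g) l‖ ^ 2) * fejer n l := by ring
      _ = g l * fejer n l := by rw [this]; field_simp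
  · refine Eventually.of_forall fun l hl => ?_
    have := hl.1.trans_le hl.2
    linarith

theorem spectralDensity_neg (γ : ℤ → ℝ) (l : ℝ) : spectralDensity γ (-l) = spectralDensity γ l := by
  simp [spectralDensity]

/-- The kernel is nonnegative with mass `2π`; evenness carries the bound from `[0, π]` over to `[-π,
π]`. -/
theorem abs_integral_fejer_sub_le {f g : ℝ → ℝ} (hf : Continuous f) (hg : Continuous g)
    (hfe : ∀ l, f (-l) = f l) (hge : ∀ l, g (-l) = g l) {η : ℝ}
    (h : ∀ l ∈ Icc 0 Real.pi, |g l - f l| ≤ η) {n : ℕ} (hn : 1 ≤ n) :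
    |(∫ l in (-Real.pi)..Real.pi, g l * fejer n l) -
      ∫ l in (-Real.pi)..Real.pi, f l * fejer n l| ≤ η * (2 * Real.pi) := by
  have hpi := Real.pi_pos
  have hF := continuous_fejer n
  rw [← intervalIntegral.integral_sub (by apply Continuous.intervalIntegrable; fun_prop)
    (by apply Continuous.intervalIntegrable; fun_prop), ← integral_fejer hn,
    ← intervalIntegral.integral_const_mul]
  refine (intervalIntegral.abs_integral_le_integral_abs (by linarith)).trans ?_
  refine intervalIntegral.integral_mono_on (by linarith)
    (by apply Continuous.intervalIntegrable; fun_prop)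
    (by apply Continuous.intervalIntegrable; fun_prop) fun l hl => ?_
  have hl' : |g l - f l| ≤ η := by
    rcases le_total 0 l with h0 | h0
    · exact h l ⟨h0, hl.2⟩
    · have := h (-l) ⟨by linarith, by linarith [hl.1]⟩
      rwa [hfe, hge] at this
  have hF0 := fejer_nonneg n l
  rw [← sub_mul, abs_mul, abs_of_nonneg hF0]
  gcongr

/-! ### Mallows distance from its square, and the main theorem -/

theorem mallows_eq (ν ν' : Measure ℝ) : mallows ν ν' = mallowsSq ν ν' ^ (1 / 2 : ℝ) := rfl

theorem mallows_le_of_mallowsSq_le {ν ν' : Measure ℝ} {ε : ℝ} (hε : 0 ≤ ε)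
    (h : mallowsSq ν ν' ≤ ENNReal.ofReal (ε ^ 2)) : mallows ν ν' ≤ ENNReal.ofReal ε := by
  rw [mallows_eq]
  calc _ ≤ ENNReal.ofReal (ε ^ 2) ^ (1 / 2 : ℝ) := ENNReal.rpow_le_rpow h (by norm_num)
    _ = ENNReal.ofReal ε := by
        rw [ENNReal.ofReal_rpow_of_nonneg (by positivity) (by norm_num), ← Real.sqrt_eq_rpow,
          Real.sqrt_sq hε]

theorem mainTheorem6 {Ω : Type*} [MeasurableSpace Ω] (P : Measure Ω) [IsProbabilityMeasure P]
    -- the process, its mean and its spectral density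
    (X : ℤ → Ω → ℝ) (m : ℝ) (f : ℝ → ℝ)
    (hstat : IsWeaklyStationary P X m)
    (hpnd : IsPurelyNondeterministic P (fun t ω => X t ω - m))
    (hγ : Summable (fun h : ℤ => |autocov P X h|))
    (hf : f = spectralDensity (autocov P X))
    (hf0 : 0 < f 0)
    (hclt : TendstoInDistribution (fun (n : ℕ) ω => √(n : ℝ) * (sampleMean (sample X n ω) - m)) atTop
      (id : ℝ → ℝ) (fun _ => P) (gaussianReal 0 (2 * Real.pi * f 0).toNNReal))
    -- the spectral density estimator driving the bootstrap: `fhat n x` is the estimate from the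
    -- data `x`
    (fhat : (n : ℕ) → (Fin n → ℝ) → ℝ → ℝ)
    (hfhat_meas : ∀ n l, Measurable (fun x => fhat n x l))
    (hfhat_shape : ∀ n ≥ 1, ∀ᵐ ω ∂P, IsSpectralShape (fhat n (sample X n ω)))
    (B : ℝ) (hfhat_bdd : ∀ n ≥ 1, ∀ᵐ ω ∂P, ∀ l, fhat n (sample X n ω) l ≤ B)
    (hfhat_log : ∀ n ≥ 1, ∀ᵐ ω ∂P, LogIntegrable (fhat n (sample X n ω)))
    (hfhat_cons : ToZeroInProb P (fun n ω =>
      ⨆ l ∈ Icc 0 Real.pi, ENNReal.ofReal |fhat n (sample X n ω) l - f l|))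
    (C : ℝ) (hfhat_wold : ∀ n ≥ 1, ∀ᵐ ω ∂P,
      Summable (fun k => |woldCoeff (fhat n (sample X n ω)) k|) ∧
        ∑' k, |woldCoeff (fhat n (sample X n ω)) k| < C)
    (V : ℝ) (hfhat_smooth : ∀ n ≥ 1, ∀ᵐ ω ∂P,
      Differentiable ℝ (fhat n (sample X n ω)) ∧
        Differentiable ℝ (deriv (fhat n (sample X n ω))) ∧
        eVariationOn (deriv (deriv (fhat n (sample X n ω)))) (Icc (-Real.pi) Real.pi)
          ≤ ENNReal.ofReal V)
    -- the law of the pseudo innovations given the data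
    (Q : (n : ℕ) → Kernel (Fin n → ℝ) ℝ) [∀ n, IsMarkovKernel (Q n)]
    (K : ℝ) (hQ : ∀ n ≥ 1, ∀ᵐ ω ∂P,
      ∫ z, z ∂(Q n (sample X n ω)) = 0 ∧
        ∫ z, z ^ 2 ∂(Q n (sample X n ω)) = innovVar (fhat n (sample X n ω)) ∧
        ∫⁻ z, ENNReal.ofReal (z ^ 4) ∂(Q n (sample X n ω)) < ENNReal.ofReal K)
    -- the estimators of `f 0`: `ftil n x` is computed from the data `x`, and `ftilStar n x y`
    -- from the pseudo observations `y` (and possibly from `x`)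
    (δ : ℝ) (hδ : 0 < δ)
    (ftil : (n : ℕ) → (Fin n → ℝ) → ℝ) (hftil_meas : ∀ n, Measurable (ftil n))
    (hftil_ge : ∀ n ≥ 1, ∀ᵐ ω ∂P, δ ≤ ftil n (sample X n ω))
    (hftil_cons : ToZeroInProb P (fun n ω => ENNReal.ofReal |ftil n (sample X n ω) - f 0|))
    (ftilStar : (n : ℕ) → (Fin n → ℝ) → (Fin n → ℝ) → ℝ)
    (hftilStar_meas : ∀ n, Measurable (Function.uncurry (ftilStar n)))
    (hftilStar_ge : ∀ n ≥ 1, ∀ᵐ ω ∂P, ∀ᵐ e ∂(innovLaw (Q n (sample X n ω))),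
      δ ≤ ftilStar n (sample X n ω) (pseudoSample (woldCoeff (fhat n (sample X n ω)))
        (sampleMean (sample X n ω)) n e))
    (hftilStar_cons : ∀ ε : ℝ, 0 < ε → ToZeroInProb P (fun n ω =>
      innovLaw (Q n (sample X n ω))
        {e | ε ≤ |ftilStar n (sample X n ω) (pseudoSample (woldCoeff (fhat n (sample X n ω)))
          (sampleMean (sample X n ω)) n e) - f 0|})) :
    -- the Mallows distance of the conditional law of the bootstrap statistic given the data and
    -- the law of the studentized mean tends to zero in probability
    ToZeroInProb P (fun n ω => mallows
      ((innovLaw (Q n (sample X n ω))).map (fun e =>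
        studentized (pseudoSample (woldCoeff (fhat n (sample X n ω)))
            (sampleMean (sample X n ω)) n e)
          (sampleMean (sample X n ω))
          (ftilStar n (sample X n ω) (pseudoSample (woldCoeff (fhat n (sample X n ω)))
            (sampleMean (sample X n ω)) n e))))
      (P.map (fun ω' => studentized (sample X n ω') m (ftil n (sample X n ω'))))) := by
  have hpi := Real.pi_pos
  have hfcont : Continuous f := hf ▸ continuous_spectralDensity hγ
  have hfeven : ∀ l, f (-l) = f l := fun l => by rw [hf, spectralDensity_neg]
  have hmain : ∀ ε : ℝ, 0 < ε → Tendsto (fun n => P {ω | ENNReal.ofReal (2 * ε) < mallows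
      ((innovLaw (Q n (sample X n ω))).map (fun e =>
        studentized (pseudoSample (woldCoeff (fhat n (sample X n ω)))
            (sampleMean (sample X n ω)) n e)
          (sampleMean (sample X n ω))
          (ftilStar n (sample X n ω) (pseudoSample (woldCoeff (fhat n (sample X n ω)))
            (sampleMean (sample X n ω)) n e))))
      (P.map (fun ω' => studentized (sample X n ω') m (ftil n (sample X n ω'))))}) atTop
      (𝓝 0) := by
    intro ε hε
    -- The thresholds are deterministic. Replacing `K` by `max K 0` supplies the required sign, and
    -- `ε ^ 2` is the accuracy for squared distances.
    obtain ⟨N, hN1, η, hη, hunif⟩ := exists_uniform_mallowsSq_bootstrap_le (K := max K 0) (C := C)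
      (ε := ε ^ 2) (le_max_right _ _) hδ hf0 (by positivity)
    have hdata := tendsto_mallowsSq_sample hstat hγ hf hf0 hclt hδ hftil_meas hftil_ge hftil_cons
    have hces := tendsto_cesaro_double_sum hγ
    rw [← two_pi_mul_spectralDensity_zero, ← hf] at hces
    -- Closeness `ρ` of the spectral estimate costs `2πρ = η/2` in the variance; the other `η/2` is
    -- left for the Cesàro limit.
    let ρ : ℝ := η / (4 * Real.pi)
    have hρ : 0 < ρ := by positivity
    have hbad := (hfhat_cons (ENNReal.ofReal ρ) (ENNReal.ofReal_pos.2 hρ)).add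
      (hftilStar_cons η hη (ENNReal.ofReal η) (ENNReal.ofReal_pos.2 hη))
    rw [add_zero] at hbad
    refine tendsto_of_tendsto_of_tendsto_of_le_of_le' tendsto_const_nhds hbad
      (Eventually.of_forall fun _ => zero_le) ?_
    filter_upwards [eventually_ge_atTop N,
      hdata.eventually (ge_mem_nhds (ENNReal.ofReal_pos.2 (by positivity : 0 < ε ^ 2))),
      hces.eventually (Metric.closedBall_mem_nhds _ (by positivity : 0 < η / 2))]
      with n hnN hn2 hn3
    have hn1 : 1 ≤ n := hN1.trans hnN
    -- Up to a null set, a large distance forces one of two events: the spectral estimate is off by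
    -- at least `ρ`, or the conditional probability of a bad variance estimate is at least `η`.
    -- Monotonicity and subadditivity need no measurability of these events.
    refine (measure_mono_ae ?_).trans (measure_union_le _ _)
    filter_upwards [hfhat_shape n hn1, hfhat_log n hn1, hfhat_wold n hn1, hfhat_smooth n hn1,
      hQ n hn1, hftilStar_ge n hn1] with ω hshape hlog hwold hsmooth hq hstar hbadω
    by_contra hgood
    obtain ⟨hsup, hstarω⟩ := not_or.1 hgood
    simp only [mem_ofPred_eq, not_le] at hsup hstarω
    refine absurd hbadω (not_lt.2 ?_)
    have hgcont := hsmooth.1.continuous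
    have hinn : IsInnovation (Q n (sample X n ω)) (innovVar (fhat n (sample X n ω))) (max K 0) :=
      ⟨hq.1, hq.2.1, hq.2.2.le.trans (ENNReal.ofReal_le_ofReal (le_max_left _ _))⟩
    have hclose : ∀ l ∈ Icc 0 Real.pi, |fhat n (sample X n ω) l - f l| ≤ ρ := fun l hl => by
      have h1 := (le_iSup₂ (f := fun l (_ : l ∈ Icc 0 Real.pi) =>
        ENNReal.ofReal |fhat n (sample X n ω) l - f l|) l hl).trans hsup.le
      exact (ENNReal.ofReal_le_ofReal_iff hρ.le).1 h1
    have hvar : |meanVar (woldCoeff (fhat n (sample X n ω))) (innovVar (fhat n (sample X n ω))) n -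
        2 * Real.pi * f 0| ≤ η := by
      rw [meanVar_woldCoeff hshape hlog hgcont hwold.1]
      have h1 := abs_integral_fejer_sub_le hfcont hgcont hfeven hshape.even hclose hn1
      have h2 := integral_spectralDensity_mul_fejer hγ hstat.autocov_neg n
      rw [← hf] at h2
      rw [← h2, Real.dist_eq] at hn3
      have h3 : ρ * (2 * Real.pi) = η / 2 := by simp only [ρ]; field_simp; norm_num
      rw [h3] at h1
      exact (abs_sub_le _ _ _).trans (by linarith)
    have hpm := hinn.aemeasurable_pseudoSample hwold.1 (sampleMean (sample X n ω)) n
    have hDm : AEMeasurable (fun e => ftilStar n (sample X n ω)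
        (pseudoSample (woldCoeff (fhat n (sample X n ω))) (sampleMean (sample X n ω)) n e))
        (innovLaw (Q n (sample X n ω))) :=
      ((hftilStar_meas n).comp measurable_prodMk_left).comp_aemeasurable hpm
    have hboot := hunif n hnN _ _ _ (sampleMean (sample X n ω)) _ inferInstance hinn hwold.1
      hwold.2.le hvar hDm hstar hstarω.le
    have hZm : AEMeasurable (fun e => scaledMean (pseudoSample (woldCoeff (fhat n (sample X n ω)))
        (sampleMean (sample X n ω)) n e) (sampleMean (sample X n ω)))
        (innovLaw (Q n (sample X n ω))) :=
      (((measurable_sampleMean n).comp_aemeasurable hpm).sub_const _).const_mul _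
    have hTm : AEMeasurable (fun e => studentized (pseudoSample (woldCoeff (fhat n (sample X n ω)))
        (sampleMean (sample X n ω)) n e) (sampleMean (sample X n ω))
        (ftilStar n (sample X n ω)
        (pseudoSample (woldCoeff (fhat n (sample X n ω))) (sampleMean (sample X n ω)) n e)))
        (innovLaw (Q n (sample X n ω))) := hZm.div (hDm.const_mul _).sqrt
    have hprob := Measure.isProbabilityMeasure_map hTm
    refine mallows_le_of_mallowsSq_le (by positivity) ?_
    -- The standard normal law is the intermediate point; two errors `ε²`, each doubled, make
    -- `(2ε)²`.
    refine (mallowsSq_le _ (gaussianReal 0 1) _).trans ?_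
    rw [mallowsSq_comm (gaussianReal 0 1)]
    calc _ ≤ 2 * ENNReal.ofReal (ε ^ 2) + 2 * ENNReal.ofReal (ε ^ 2) :=
          add_le_add (mul_le_mul_right hboot _) (mul_le_mul_right hn2 _)
      _ = ENNReal.ofReal ((2 * ε) ^ 2) := by
          have h2 : (2 : ℝ≥0∞) = ENNReal.ofReal 2 := by simp
          rw [h2, ← ENNReal.ofReal_mul zero_le_two, ← ENNReal.ofReal_add (by positivity)
            (by positivity)]
          congr 1; ring
  intro ε hε
  -- The level `ε` may be infinite, so a finite positive `r` below it is used; `r < ε` also turns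
  -- the weak inequality into a strict one.
  obtain ⟨r, hr0, hrε⟩ := ENNReal.lt_iff_exists_nnreal_btwn.1 hε
  have hr : (0 : ℝ) < r := by exact_mod_cast hr0
  refine tendsto_of_tendsto_of_tendsto_of_le_of_le tendsto_const_nhds
    (hmain (r / 2) (by positivity)) (fun _ => zero_le) fun n => measure_mono ?_
  intro ω hω
  simp only [mem_ofPred_eq] at hω ⊢
  refine lt_of_lt_of_le ?_ hω
  rwa [mul_div_cancel₀ _ two_ne_zero, ENNReal.ofReal_coe_nnreal]
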